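/- Let $X$ be a compact complex manifold of complex dimension $n\ge 3$ (Hausdorff, without boundary, with its complex orientation), and let $F$ be the fundamental form of a smooth Hermitian metric on $X$, i.e. $F(u,v)=g(Ju,v)$, where $J$ is the complex structure of $X$ and $g$ is a smooth Riemannian metric on $X$ with $g(J\cdot,J\cdot)=g$. Write $F^k=F\wedge\dots\wedge F$ ($k$ factors, $F^0=1$). Then for every integer $k$ with $1\le k\le n-1$, $$\int_X \partial\bar\partial F^k\wedge F^{n-k-1}=\frac{k(n-k-1)}{n-2}\int_X \partial\bar\partial F\wedge F^{n-2}.$$ -/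

import Mathlib

open scoped Manifold ContDiff

noncomputable section

namespace ComplexManifold

/-! ### Exterior algebra on one vector space -/

section Wedge

variable {V : Type*} [AddCommGroup V] [Module ℝ V] [TopologicalSpace V]

/-- The exterior product of complex-valued alternating forms, in the normalization
`(a ∧ b)(v₁, …, v_{p+q}) = ∑ sign σ • a(v_{σ 1}, …, v_{σ p}) * b(v_{σ (p+1)}, …, v_{σ (p+q)})`,
summed over the `(p,q)`-shuffles `σ`. -/
def wedge {p q : ℕ} (a : V [⋀^Fin p]→L[ℝ] ℂ) (b : V [⋀^Fin q]→L[ℝ] ℂ) :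
    V [⋀^Fin (p + q)]→L[ℝ] ℂ :=
  { ((LinearMap.mul' ℝ ℂ).compAlternatingMap
      (a.toAlternatingMap.domCoprod b.toAlternatingMap)).domDomCongr finSumFinEquiv with
    cont := by
      change Continuous fun v : Fin (p + q) → V => LinearMap.mul' ℝ ℂ
        ((a.toAlternatingMap.domCoprod b.toAlternatingMap) fun i => v (finSumFinEquiv i))
      simp only [AlternatingMap.domCoprod_apply, sum_apply, map_sum]
      refine continuous_finsetSum _ fun σ _ => ?_
      induction σ using Quotient.inductionOn' with
      | _ σ =>
        simp only [AlternatingMap.domCoprod.summand_mk'', smul_apply,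
          MultilinearMap.domDomCongr_apply, MultilinearMap.domCoprod_apply,
          LinearMap.map_smul_of_tower, LinearMap.mul'_apply]
        refine Continuous.const_smul (Continuous.mul ?_ ?_) _
        · exact a.cont.comp (continuous_pi fun i => continuous_apply _)
        · exact b.cont.comp (continuous_pi fun i => continuous_apply _) }

end Wedge

/-! ### `∂` and `∂̄` on `ℂⁿ`

A complex-valued differential form of degree `m` on (an open subset of) `ℂⁿ` is a map
`(Fin n → ℂ) → (Fin n → ℂ) [⋀^Fin m]→L[ℝ] ℂ`. -/

section Local

variable {n m : ℕ}

/-- Multiplication by `i` on `ℂⁿ`, as a real-linear map. -/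
def mulI (n : ℕ) : (Fin n → ℂ) →L[ℝ] (Fin n → ℂ) :=
  Complex.I • ContinuousLinearMap.id ℝ (Fin n → ℂ)

/-- `∂α = ∑ⱼ dzⱼ ∧ ∂α/∂zⱼ`: as for the exterior derivative `extDeriv`, one alternates
the derivative of `α`, but only its `ℂ`-linear part `v ↦ (Dα(v) - i Dα(iv)) / 2`.
On `α = f dz_I ∧ dz̄_J` this is `∑ⱼ (∂f/∂zⱼ) dzⱼ ∧ dz_I ∧ dz̄_J`. -/
def delLocal (α : (Fin n → ℂ) → (Fin n → ℂ) [⋀^Fin m]→L[ℝ] ℂ) (z : Fin n → ℂ) :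
    (Fin n → ℂ) [⋀^Fin (m + 1)]→L[ℝ] ℂ :=
  .alternatizeUncurryFin
    ((2⁻¹ : ℂ) • (fderiv ℝ α z - Complex.I • (fderiv ℝ α z).comp (mulI n)))

/-- `∂̄α = ∑ⱼ dz̄ⱼ ∧ ∂α/∂z̄ⱼ`: one alternates the conjugate-linear part
`v ↦ (Dα(v) + i Dα(iv)) / 2` of the derivative of `α`. -/
def delbarLocal (α : (Fin n → ℂ) → (Fin n → ℂ) [⋀^Fin m]→L[ℝ] ℂ) (z : Fin n → ℂ) :
    (Fin n → ℂ) [⋀^Fin (m + 1)]→L[ℝ] ℂ :=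
  .alternatizeUncurryFin
    ((2⁻¹ : ℂ) • (fderiv ℝ α z + Complex.I • (fderiv ℝ α z).comp (mulI n)))

/-- The basis `e₁, i e₁, …, eₙ, i eₙ` of `ℂⁿ` over `ℝ`, positive for the complex orientation. -/
def realFrame (n : ℕ) (j : Fin (2 * n)) : Fin n → ℂ :=
  Pi.single ⟨j / 2, by omega⟩ (if (j : ℕ) % 2 = 0 then 1 else Complex.I)

end Local

/-! ### Complex manifolds -/

section Manifold

/-- The real smooth manifold underlying a complex manifold. -/
instance isManifold_real (n : ℕ) (X : Type*) [TopologicalSpace X] [ChartedSpace (Fin n → ℂ) X]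
    [h : IsManifold 𝓘(ℂ, Fin n → ℂ) ω X] : IsManifold 𝓘(ℝ, Fin n → ℂ) ∞ X := by
  apply isManifold_of_contDiffOn
  intro e e' he he'
  have := (contDiffGroupoid ω 𝓘(ℂ, Fin n → ℂ)).compatible he he'
  rw [contDiffGroupoid, mem_groupoid_of_pregroupoid] at this
  exact ((this.1).restrict_scalars ℝ).of_le le_top

variable (n : ℕ) (X : Type*) [TopologicalSpace X] [ChartedSpace (Fin n → ℂ) X]

/-- A (not necessarily smooth) complex-valued differential form of degree `m` on the complex
manifold `X`: a field of alternating `ℝ`-multilinear forms on the tangent spaces. -/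
abbrev Form (m : ℕ) : Type _ := ∀ x : X, TangentSpace 𝓘(ℝ, Fin n → ℂ) x [⋀^Fin m]→L[ℝ] ℂ

variable {n X}

/-- The complex structure `J` of the tangent space at `x`. Mathlib identifies the tangent space
with `ℂⁿ` by means of the holomorphic chart `chartAt _ x`, and `J` is the multiplication by `i`. -/
def complexStructure (x : X) :
    TangentSpace 𝓘(ℝ, Fin n → ℂ) x →L[ℝ] TangentSpace 𝓘(ℝ, Fin n → ℂ) x :=
  mulI n

namespace Form

variable {m p q : ℕ}

/-- The form `α` in the holomorphic chart `φ` at `c`, that is, the pullback of `α` under `φ⁻¹`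
(meaningful on the target of `φ`). -/
def inChart (α : Form n X m) (c : X) (z : Fin n → ℂ) : (Fin n → ℂ) [⋀^Fin m]→L[ℝ] ℂ :=
  (α ((chartAt (Fin n → ℂ) c).symm z)).compContinuousLinearMap
    (mfderiv 𝓘(ℝ, Fin n → ℂ) 𝓘(ℝ, Fin n → ℂ) (chartAt (Fin n → ℂ) c).symm z)

/-- `∂α`, computed at `x` in the holomorphic chart at `x`. -/
def del (α : Form n X m) : Form n X (m + 1) := fun x =>
  (delLocal (α.inChart x) (chartAt (Fin n → ℂ) x x)).compContinuousLinearMap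
    (mfderiv 𝓘(ℝ, Fin n → ℂ) 𝓘(ℝ, Fin n → ℂ) (chartAt (Fin n → ℂ) x) x)

/-- `∂̄α`, computed at `x` in the holomorphic chart at `x`. -/
def delbar (α : Form n X m) : Form n X (m + 1) := fun x =>
  (delbarLocal (α.inChart x) (chartAt (Fin n → ℂ) x x)).compContinuousLinearMap
    (mfderiv 𝓘(ℝ, Fin n → ℂ) 𝓘(ℝ, Fin n → ℂ) (chartAt (Fin n → ℂ) x) x)

/-- The exterior product `α ∧ β` of differential forms. -/
def wedge (α : Form n X p) (β : Form n X q) : Form n X (p + q) := fun x =>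
  ComplexManifold.wedge (α x) (β x)

/-- The exterior power `αᵏ = α ∧ ⋯ ∧ α` of a 2-form, with `α⁰ = 1`. -/
def pow (α : Form n X 2) : (k : ℕ) → Form n X (2 * k)
  | 0 => fun _ => ContinuousAlternatingMap.constOfIsEmpty ℝ _ (Fin 0) 1
  | k + 1 => (α.pow k).wedge α

/-- The function `f` such that the top-degree form `α` is `f dx₁ ∧ dy₁ ∧ ⋯ ∧ dxₙ ∧ dyₙ` in the
chart at `c`, where `zⱼ = xⱼ + i yⱼ` are the coordinates. -/
def density (hm : m = 2 * n) (α : Form n X m) (c : X) (z : Fin n → ℂ) : ℂ :=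
  α.inChart c z fun j => realFrame n (Fin.cast hm j)

variable [T2Space X] [CompactSpace X] [IsManifold 𝓘(ℂ, Fin n → ℂ) ω X]

variable (n X) in
/-- A smooth partition of unity `(ρ_c)` on `X`, with `ρ_c` supported in the domain of the
holomorphic chart at `c`. -/
def chartPartition : SmoothPartitionOfUnity X 𝓘(ℝ, Fin n → ℂ) X Set.univ :=
  (SmoothPartitionOfUnity.exists_isSubordinate_chartAt_source 𝓘(ℝ, Fin n → ℂ) X).choose

/-- The integral over `X`, with its complex orientation, of a form of degree `m = 2n`:
`∫_X α = ∑_c ∫ ρ_c α`, where the form `ρ_c α`, supported in the domain of the chart at `c`, is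
integrated against Lebesgue measure in that chart. By compactness only finitely many `ρ_c` are
nonzero. -/
def integral (hm : m = 2 * n) (α : Form n X m) : ℂ :=
  ∑ᶠ c : X, ∫ z in (chartAt (Fin n → ℂ) c).target,
    (chartPartition n X c ((chartAt (Fin n → ℂ) c).symm z) : ℂ) * α.density hm c z

end Form

variable (n X) in
/-- A Hermitian metric on the complex manifold `X`: a smooth Riemannian metric `g` with
`g(Ju, Jv) = g(u, v)`. -/
structure HermitianMetric [IsManifold 𝓘(ℂ, Fin n → ℂ) ω X] extends
    Bundle.ContMDiffRiemannianMetric 𝓘(ℝ, Fin n → ℂ) ∞ (Fin n → ℂ)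
      (fun x : X => TangentSpace 𝓘(ℝ, Fin n → ℂ) x) where
  inner_J (x : X) (u v : TangentSpace 𝓘(ℝ, Fin n → ℂ) x) :
    inner x (complexStructure x u) (complexStructure x v) = inner x u v

namespace HermitianMetric

variable [IsManifold 𝓘(ℂ, Fin n → ℂ) ω X]

theorem inner_J_self (g : HermitianMetric n X) (x : X) (u : TangentSpace 𝓘(ℝ, Fin n → ℂ) x) :
    g.inner x (complexStructure x u) u = 0 := by
  have hJ : complexStructure x (complexStructure x u) = -u := by
    change Complex.I • (Complex.I • (show Fin n → ℂ from u)) = -(show Fin n → ℂ from u)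
    rw [smul_smul, Complex.I_mul_I, neg_one_smul]
  have h := g.inner_J x (complexStructure x u) u
  rw [hJ, map_neg, neg_apply, g.symm] at h
  linarith

/-- The fundamental form `F(u, v) = g(Ju, v)` of a Hermitian metric: in coordinates,
`F = (i/2) ∑ h_{jk} dz_j ∧ dz̄_k`, where `h` is the Hermitian form with real part `g`. -/
def fundamentalForm (g : HermitianMetric n X) : Form n X 2 := fun x =>
  { toFun := fun v => (g.inner x (complexStructure x (v 0)) (v 1) : ℂ)
    map_update_add' := by
      intro d v i a b
      rw [Subsingleton.elim d inferInstance]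
      fin_cases i <;> simp [Function.update]
    map_update_smul' := by
      intro d v i c a
      rw [Subsingleton.elim d inferInstance]
      fin_cases i <;> simp [Function.update]
    cont := by
      let b : (Fin n → ℂ) →L[ℝ] (Fin n → ℂ) →L[ℝ] ℝ := g.inner x
      change Continuous fun v : Fin 2 → Fin n → ℂ => ((b (mulI n (v 0)) (v 1) : ℝ) : ℂ)
      exact Complex.continuous_ofReal.comp (b.continuous₂.comp
        (((mulI n).continuous.comp (continuous_apply 0)).prodMk (continuous_apply 1)))
    map_eq_zero_of_eq' := by
      intro v i j hv hij
      have : v 1 = v 0 := by fin_cases i <;> fin_cases j <;> simp_all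
      simp [this, g.inner_J_self] }

end HermitianMetric

end Manifold

end ComplexManifold

end

/-! Put k = j + 1 and l = n - k - 1, so that j + l = n - 2. A 2-form is central in the exterior
algebra, so the Leibniz rule gives ∂̄F^(j+1) = (j+1) ∂̄F ∧ F^j. As ∂̄F has odd degree, ∂∂̄F^(j+1) ∧
F^l = (j+1) (∂∂̄F ∧ F^(j+l) - ∂̄F ∧ ∂F^j ∧ F^l). Here (j+l) ∂F^j ∧ F^l = j ∂F^(j+l), while ∂̄F ∧
∂F^(j+l) = ∂∂̄F ∧ F^(j+l) - ∂(∂̄F ∧ F^(j+l)). Hence, up to a ∂-exact form, (j+l) ∂∂̄F^(j+1) ∧ F^l is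
(j+1)(j+l-j) = (j+1)l times ∂∂̄F ∧ F^(j+l) (`Form.toRing_diff_diff_pow_wedge`), and Stokes' theorem
(`Form.integral_diff_eq_zero`) removes the exact form.

The pointwise algebra takes place in the graded ring `FormRing`, where no casts between degrees
occur. The operators ∂ and ∂̄ are the cases κ = -i and κ = i of one operator `dLocal`. It obeys the
Leibniz rule (`toRing_dLocal_wedge`) and commutes with holomorphic pullback (`dLocal_pullback`).
Stokes' theorem holds for each operator separately, without a bidegree decomposition, because in
coordinates both are constant-coefficient combinations of directional derivatives. Of F itself only
smoothness is used. -/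

noncomputable section

namespace ComplexManifold

/-! ### The exterior product of alternating forms -/

section SkewSum

open Equiv

variable {V : Type*} {p q : ℕ}

/-- The sum `∑ sign σ • A (v ∘ σ)` over all permutations of the arguments of `A`. -/
def skewSum (m : ℕ) (A : (Fin m → V) → ℂ) (v : Fin m → V) : ℂ :=
  ∑ σ : Perm (Fin m), (Perm.sign σ : ℂ) * A (v ∘ σ)

/-- Reindexing by τ ↦ τσ⁻¹. All signs in the exterior algebra below come from this rule. -/
theorem skewSum_comp_perm (A : (Fin p → V) → ℂ) (σ : Perm (Fin p)) (v : Fin p → V) :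
    skewSum p (fun w => A (w ∘ σ)) v = (Perm.sign σ : ℂ) * skewSum p A v := by
  simp only [skewSum, Finset.mul_sum]
  rw [← Equiv.sum_comp (Equiv.mulRight σ⁻¹)]
  refine Finset.sum_congr rfl fun τ _ => ?_
  simp only [Equiv.coe_mulRight, Perm.sign_mul, Perm.sign_inv]
  rw [Function.comp_assoc, ← Perm.coe_mul, inv_mul_cancel_right]
  push_cast
  ring

theorem skewSum_comp_cast (h : p = q) (A : (Fin p → V) → ℂ) (v : Fin q → V) :
    skewSum q (fun w => A (w ∘ Fin.cast h)) v = skewSum p A (v ∘ Fin.cast h) := by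
  subst h; rfl

theorem skewSum_mul_left (c : ℂ) (A : (Fin p → V) → ℂ) (v : Fin p → V) :
    skewSum p (fun w => c * A w) v = c * skewSum p A v := by
  simp only [skewSum, Finset.mul_sum]
  exact Finset.sum_congr rfl fun _ _ => by ring

/-- Antisymmetrizing twice: the first factor may be antisymmetrized beforehand. -/
theorem skewSum_skewSum_left (A : (Fin p → V) → ℂ) (B : (Fin q → V) → ℂ)
    (v : Fin (p + q) → V) :
    skewSum (p + q) (fun w => skewSum p A (w ∘ Fin.castAdd q) * B (w ∘ Fin.natAdd p)) v =
      (p.factorial : ℂ) *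
        skewSum (p + q) (fun w => A (w ∘ Fin.castAdd q) * B (w ∘ Fin.natAdd p)) v := by
  -- Extend τ by the identity on the last q places: each of the p! terms of the inner sum
  -- contributes the same amount.
  have key (τ : Perm (Fin p)) :
      (Perm.sign τ : ℂ) * skewSum (p + q) (fun w => A ((w ∘ Fin.castAdd q) ∘ τ) *
        B (w ∘ Fin.natAdd p)) v =
      skewSum (p + q) (fun w => A (w ∘ Fin.castAdd q) * B (w ∘ Fin.natAdd p)) v := by
    let σ : Perm (Fin (p + q)) := finSumFinEquiv.permCongr (Perm.sumCongr τ 1)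
    have hσ : Perm.sign σ = Perm.sign τ := by simp [σ]
    have := skewSum_comp_perm (fun w => A (w ∘ Fin.castAdd q) * B (w ∘ Fin.natAdd p)) σ v
    have e1 (w : Fin (p + q) → V) : (w ∘ σ) ∘ Fin.castAdd q = (w ∘ Fin.castAdd q) ∘ τ := by
      ext i; simp [σ]
    have e2 (w : Fin (p + q) → V) : (w ∘ σ) ∘ Fin.natAdd p = w ∘ Fin.natAdd p := by
      ext i; simp [σ]
    simp only [e1, e2] at this
    rw [this, hσ, ← mul_assoc]
    rcases Int.units_eq_one_or (Perm.sign τ) with h | h <;> simp [h]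
  calc _ = ∑ τ : Perm (Fin p), (Perm.sign τ : ℂ) *
        skewSum (p + q) (fun w => A ((w ∘ Fin.castAdd q) ∘ τ) * B (w ∘ Fin.natAdd p)) v := by
        simp only [skewSum, Finset.sum_mul, Finset.mul_sum]
        rw [Finset.sum_comm]
        refine Finset.sum_congr rfl fun _ _ => Finset.sum_congr rfl fun _ _ => by ring
    _ = _ := by simp [key, Fintype.card_perm]

theorem skewSum_skewSum_right (A : (Fin p → V) → ℂ) (B : (Fin q → V) → ℂ)
    (v : Fin (p + q) → V) :
    skewSum (p + q) (fun w => A (w ∘ Fin.castAdd q) * skewSum q B (w ∘ Fin.natAdd p)) v =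
      (q.factorial : ℂ) *
        skewSum (p + q) (fun w => A (w ∘ Fin.castAdd q) * B (w ∘ Fin.natAdd p)) v := by
  have key (τ : Perm (Fin q)) :
      (Perm.sign τ : ℂ) * skewSum (p + q) (fun w => A (w ∘ Fin.castAdd q) *
        B ((w ∘ Fin.natAdd p) ∘ τ)) v =
      skewSum (p + q) (fun w => A (w ∘ Fin.castAdd q) * B (w ∘ Fin.natAdd p)) v := by
    let σ : Perm (Fin (p + q)) := finSumFinEquiv.permCongr (Perm.sumCongr 1 τ)
    have hσ : Perm.sign σ = Perm.sign τ := by simp [σ]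
    have := skewSum_comp_perm (fun w => A (w ∘ Fin.castAdd q) * B (w ∘ Fin.natAdd p)) σ v
    have e1 (w : Fin (p + q) → V) : (w ∘ σ) ∘ Fin.castAdd q = w ∘ Fin.castAdd q := by
      ext i; simp [σ]
    have e2 (w : Fin (p + q) → V) : (w ∘ σ) ∘ Fin.natAdd p = (w ∘ Fin.natAdd p) ∘ τ := by
      ext i; simp [σ]
    simp only [e1, e2] at this
    rw [this, hσ, ← mul_assoc]
    rcases Int.units_eq_one_or (Perm.sign τ) with h | h <;> simp [h]
  calc _ = ∑ τ : Perm (Fin q), (Perm.sign τ : ℂ) *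
        skewSum (p + q) (fun w => A (w ∘ Fin.castAdd q) * B ((w ∘ Fin.natAdd p) ∘ τ)) v := by
        simp only [skewSum, Finset.mul_sum]
        rw [Finset.sum_comm]
        refine Finset.sum_congr rfl fun _ _ => Finset.sum_congr rfl fun _ _ => by ring
    _ = _ := by simp [key, Fintype.card_perm]

theorem factorial_cast_ne_zero (p : ℕ) : (p.factorial : ℂ) ≠ 0 :=
  Nat.cast_ne_zero.2 p.factorial_ne_zero

end SkewSum

/-! ### Bilinearity, associativity and graded commutativity of the wedge product -/

section WedgeAlgebra

open Equiv

variable {V W : Type*} [AddCommGroup V] [Module ℝ V] [TopologicalSpace V]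
  [AddCommGroup W] [Module ℝ W] [TopologicalSpace W]
variable {p q r : ℕ}

theorem skewSum_alternating (a : V [⋀^Fin p]→L[ℝ] ℂ) (v : Fin p → V) :
    skewSum p a v = (p.factorial : ℂ) * a v := by
  have h (σ : Perm (Fin p)) : (Perm.sign σ : ℂ) * a (v ∘ σ) = a v := by
    have := a.toAlternatingMap.map_perm v σ
    change a (v ∘ σ) = _ • a v at this
    rw [this]
    rcases Int.units_eq_one_or (Perm.sign σ) with h | h <;> simp [h]
  simp [skewSum, h, Fintype.card_perm]

/-- Trades the sum over shuffles for a sum over all permutations, in which every shuffle is counted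
p! q! times. -/
theorem factorial_mul_wedge_apply (a : V [⋀^Fin p]→L[ℝ] ℂ) (b : V [⋀^Fin q]→L[ℝ] ℂ)
    (v : Fin (p + q) → V) :
    ((p.factorial : ℂ) * q.factorial) * wedge a b v =
      skewSum (p + q) (fun w => a (w ∘ Fin.castAdd q) * b (w ∘ Fin.natAdd p)) v := by
  have h := MultilinearMap.domCoprod_alternization_eq a.toAlternatingMap b.toAlternatingMap
  have h2 := congrArg (fun f => LinearMap.mul' ℝ ℂ (f (v ∘ finSumFinEquiv))) h
  simp only [Fintype.card_fin, MultilinearMap.alternatization_apply, AlternatingMap.smul_apply,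
    map_nsmul, map_sum] at h2
  have h3 : wedge a b v = LinearMap.mul' ℝ ℂ
      ((a.toAlternatingMap.domCoprod b.toAlternatingMap) (v ∘ finSumFinEquiv)) := rfl
  rw [h3, ← Nat.cast_mul, ← nsmul_eq_mul, ← h2, skewSum,
    ← (Equiv.permCongr (finSumFinEquiv (m := p) (n := q))).sum_comp]
  refine Finset.sum_congr rfl fun σ _ => ?_
  rw [Perm.sign_permCongr, LinearMap.map_smul_of_tower, Units.smul_def, zsmul_eq_mul]
  congr 1
  simp [MultilinearMap.domCoprod_apply]
  congr 2 <;> ext i <;> simp [Function.comp_def]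

theorem wedge_apply_eq (a : V [⋀^Fin p]→L[ℝ] ℂ) (b : V [⋀^Fin q]→L[ℝ] ℂ)
    (v : Fin (p + q) → V) :
    wedge a b v = ((p.factorial : ℂ) * q.factorial)⁻¹ *
      skewSum (p + q) (fun w => a (w ∘ Fin.castAdd q) * b (w ∘ Fin.natAdd p)) v := by
  rw [← factorial_mul_wedge_apply, inv_mul_cancel_left₀]
  exact mul_ne_zero (factorial_cast_ne_zero p) (factorial_cast_ne_zero q)

theorem wedge_add (a : V [⋀^Fin p]→L[ℝ] ℂ) [IsTopologicalAddGroup V]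
    (b b' : V [⋀^Fin q]→L[ℝ] ℂ) :
    wedge a (b + b') = wedge a b + wedge a b' := by
  ext v
  simp only [wedge_apply_eq, skewSum, ContinuousAlternatingMap.add_apply, mul_add,
    Finset.sum_add_distrib]

theorem add_wedge [IsTopologicalAddGroup V] (a a' : V [⋀^Fin p]→L[ℝ] ℂ)
    (b : V [⋀^Fin q]→L[ℝ] ℂ) :
    wedge (a + a') b = wedge a b + wedge a' b := by
  ext v
  simp only [wedge_apply_eq, skewSum, ContinuousAlternatingMap.add_apply, mul_add, add_mul,
    Finset.sum_add_distrib]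

theorem wedge_zero (a : V [⋀^Fin p]→L[ℝ] ℂ) : wedge a (0 : V [⋀^Fin q]→L[ℝ] ℂ) = 0 := by
  ext v
  simp [wedge_apply_eq, skewSum]

theorem zero_wedge (b : V [⋀^Fin q]→L[ℝ] ℂ) : wedge (0 : V [⋀^Fin p]→L[ℝ] ℂ) b = 0 := by
  ext v
  simp [wedge_apply_eq, skewSum]

theorem smul_wedge (c : ℂ) (a : V [⋀^Fin p]→L[ℝ] ℂ) (b : V [⋀^Fin q]→L[ℝ] ℂ) :
    wedge (c • a) b = c • wedge a b := by
  ext v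
  simp only [wedge_apply_eq, ContinuousAlternatingMap.smul_apply, smul_eq_mul, mul_assoc,
    skewSum_mul_left]
  ring

theorem wedge_smul (c : ℂ) (a : V [⋀^Fin p]→L[ℝ] ℂ) (b : V [⋀^Fin q]→L[ℝ] ℂ) :
    wedge a (c • b) = c • wedge a b := by
  ext v
  simp only [wedge_apply_eq, ContinuousAlternatingMap.smul_apply, smul_eq_mul,
    mul_left_comm _ c, skewSum_mul_left]

theorem wedge_compContinuousLinearMap (a : V [⋀^Fin p]→L[ℝ] ℂ) (b : V [⋀^Fin q]→L[ℝ] ℂ)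
    (f : W →L[ℝ] V) :
    (wedge a b).compContinuousLinearMap f =
      wedge (a.compContinuousLinearMap f) (b.compContinuousLinearMap f) := by
  ext v
  simp only [wedge_apply_eq, ContinuousAlternatingMap.compContinuousLinearMap_apply, skewSum]
  rfl

/-- Both sides are the antisymmetrization of a ⊗ b ⊗ c divided by p! q! r!; the factorials of p + q
and q + r cancel against the inner antisymmetrization. -/
theorem wedge_assoc_apply (a : V [⋀^Fin p]→L[ℝ] ℂ) (b : V [⋀^Fin q]→L[ℝ] ℂ)
    (c : V [⋀^Fin r]→L[ℝ] ℂ) (v : Fin (p + (q + r)) → V) :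
    wedge (wedge a b) c (v ∘ Fin.cast (add_assoc p q r)) = wedge a (wedge b c) v := by
  have hp := factorial_cast_ne_zero p
  have hq := factorial_cast_ne_zero q
  have hr := factorial_cast_ne_zero r
  have hpq := factorial_cast_ne_zero (p + q)
  have hqr := factorial_cast_ne_zero (q + r)
  have h1 : (fun w : Fin (p + q + r) → V =>
      wedge a b (w ∘ Fin.castAdd r) * c (w ∘ Fin.natAdd (p + q)))
      = fun w => ((p.factorial : ℂ) * q.factorial)⁻¹ * (skewSum (p + q)
        (fun w => a (w ∘ Fin.castAdd q) * b (w ∘ Fin.natAdd p)) (w ∘ Fin.castAdd r) *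
          c (w ∘ Fin.natAdd (p + q))) := by
    ext w; rw [wedge_apply_eq, mul_assoc]
  have h2 : (fun w : Fin (p + (q + r)) → V => a (w ∘ Fin.castAdd (q + r)) *
      wedge b c (w ∘ Fin.natAdd p))
      = fun w => ((q.factorial : ℂ) * r.factorial)⁻¹ * (a (w ∘ Fin.castAdd (q + r)) *
        skewSum (q + r) (fun w => b (w ∘ Fin.castAdd r) * c (w ∘ Fin.natAdd q))
          (w ∘ Fin.natAdd p)) := by
    ext w; rw [wedge_apply_eq]; ring
  rw [wedge_apply_eq, wedge_apply_eq a, h1, h2, skewSum_mul_left, skewSum_mul_left]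
  rw [skewSum_skewSum_left (p := p + q) (q := r)
      (fun w => a (w ∘ Fin.castAdd q) * b (w ∘ Fin.natAdd p)) c,
    skewSum_skewSum_right (p := p) (q := q + r) a
      (fun w => b (w ∘ Fin.castAdd r) * c (w ∘ Fin.natAdd q)),
    ← skewSum_comp_cast (add_assoc p q r)]
  have h3 : (fun w : Fin (p + (q + r)) → V =>
      a (((w ∘ Fin.cast (add_assoc p q r)) ∘ Fin.castAdd r) ∘ Fin.castAdd q) *
        b (((w ∘ Fin.cast (add_assoc p q r)) ∘ Fin.castAdd r) ∘ Fin.natAdd p) *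
        c ((w ∘ Fin.cast (add_assoc p q r)) ∘ Fin.natAdd (p + q))) =
      fun w => a (w ∘ Fin.castAdd (q + r)) * (b ((w ∘ Fin.natAdd p) ∘ Fin.castAdd r) *
        c ((w ∘ Fin.natAdd p) ∘ Fin.natAdd q)) := by
    ext w
    rw [mul_assoc]
    congr 3
    ext i
    simp only [Function.comp_apply]
    congr 1
    ext
    simp [add_assoc]
  rw [h3]
  field_simp

/-- The sign of the block swap stays unevaluated; it is only needed for blocks of length 1 and 2,
where the swap is a power of a rotation. -/
theorem wedge_swap_apply (a : V [⋀^Fin p]→L[ℝ] ℂ) (b : V [⋀^Fin q]→L[ℝ] ℂ)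
    (v : Fin (p + q) → V) :
    wedge b a (v ∘ Fin.cast (add_comm q p)) =
      (Perm.sign ((finAddFlip (m := p) (n := q)).trans (finCongr (add_comm q p))) : ℂ) *
        wedge a b v := by
  rw [wedge_apply_eq, wedge_apply_eq, mul_left_comm, ← skewSum_comp_perm,
    ← skewSum_comp_cast (add_comm q p), mul_comm (p.factorial : ℂ)]
  congr 2
  ext w
  rw [mul_comm]
  congr 2 <;> ext i <;> simp [Function.comp_def]

theorem constOfIsEmpty_wedge_apply (a : V [⋀^Fin p]→L[ℝ] ℂ) (c : ℂ) (v : Fin p → V) :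
    wedge (ContinuousAlternatingMap.constOfIsEmpty ℝ V (Fin 0) c) a
      (v ∘ Fin.cast (zero_add p)) = c * a v := by
  rw [wedge_apply_eq, ← skewSum_comp_cast (zero_add p)]
  have : (fun w : Fin p → V => (ContinuousAlternatingMap.constOfIsEmpty ℝ V (Fin 0) c)
      ((w ∘ Fin.cast (zero_add p)) ∘ Fin.castAdd p) *
        a ((w ∘ Fin.cast (zero_add p)) ∘ Fin.natAdd 0)) = fun w => c * a w := by
    ext w
    congr 2
    ext i
    simp
  rw [this, skewSum_mul_left, skewSum_alternating]
  have hp := factorial_cast_ne_zero p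
  simp
  field_simp

theorem wedge_constOfIsEmpty_apply (a : V [⋀^Fin p]→L[ℝ] ℂ) (c : ℂ) (v : Fin p → V) :
    wedge a (ContinuousAlternatingMap.constOfIsEmpty ℝ V (Fin 0) c) v = c * a v := by
  rw [wedge_apply_eq]
  have : (fun w : Fin (p + 0) → V => a (w ∘ Fin.castAdd 0) *
      (ContinuousAlternatingMap.constOfIsEmpty ℝ V (Fin 0) c) (w ∘ Fin.natAdd p)) =
      fun w => c * a w := by
    ext w
    rw [mul_comm]
    rfl
  rw [this]
  change _ * skewSum p (fun w => c * a w) v = _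
  rw [skewSum_mul_left, skewSum_alternating]
  have hp := factorial_cast_ne_zero p
  simp
  field_simp

end WedgeAlgebra

/-! ### Wedge products with 1-forms -/

section OneForm

open Equiv

variable {V : Type*} [NormedAddCommGroup V] [NormedSpace ℝ V] {m : ℕ}

/-- Links the wedge product to the alternation that defines ∂ and ∂̄. -/
theorem wedge_ofSubsingleton_apply (l : V →L[ℝ] ℂ) (a : V [⋀^Fin m]→L[ℝ] ℂ)
    (v : Fin (m + 1) → V) :
    wedge (ContinuousAlternatingMap.ofSubsingleton ℝ V ℂ (0 : Fin 1) l) a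
        (v ∘ Fin.cast (add_comm 1 m)) =
      ∑ i : Fin (m + 1), (-1) ^ (i : ℕ) * (l (v i) * a (i.removeNth v)) := by
  set B := ContinuousAlternatingMap.alternatizeUncurryFin (l.smulRight a) with hB
  have hBv (w : Fin (m + 1) → V) :
      B w = ∑ i : Fin (m + 1), (-1) ^ (i : ℕ) * (l (w i) * a (i.removeNth w)) := by
    simp [hB, ContinuousAlternatingMap.alternatizeUncurryFin_apply]
  have hsum := skewSum_alternating B v
  set S := skewSum (m + 1) (fun w => l (w 0) * a (Fin.tail w)) v with hS
  -- The cycle moving place i to the front has sign (-1)^i, which cancels the sign of the i-th term.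
  -- So all m + 1 terms antisymmetrize to S, and (m+1)! B v = (m+1) S.
  have hi (i : Fin (m + 1)) :
      skewSum (m + 1) (fun w => (-1) ^ (i : ℕ) * (l (w i) * a (i.removeNth w))) v = S := by
    rw [skewSum_mul_left]
    have h := skewSum_comp_perm (fun w => l (w i) * a (i.removeNth w)) (i.cycleRange) v
    have e1 (w : Fin (m + 1) → V) : (w ∘ i.cycleRange) i = w 0 := by simp
    have e2 (w : Fin (m + 1) → V) : i.removeNth (w ∘ i.cycleRange) = Fin.tail w := by
      ext j; simp [Fin.removeNth, Fin.tail]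
    simp only [e1, e2] at h
    rw [hS, h]
    simp
  have hS' : skewSum (m + 1) B v = (m + 1 : ℂ) * S := by
    have : skewSum (m + 1) B v = ∑ i : Fin (m + 1),
        skewSum (m + 1) (fun w => (-1) ^ (i : ℕ) * (l (w i) * a (i.removeNth w))) v := by
      simp only [skewSum, hBv, Finset.mul_sum]
      rw [Finset.sum_comm]
    simp [this, hi]
  rw [← hBv, wedge_apply_eq, ← skewSum_comp_cast (add_comm 1 m)]
  have h3 : (fun w : Fin (m + 1) → V =>
      ContinuousAlternatingMap.ofSubsingleton ℝ V ℂ (0 : Fin 1) l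
        ((w ∘ Fin.cast (add_comm 1 m)) ∘ Fin.castAdd m) *
        a ((w ∘ Fin.cast (add_comm 1 m)) ∘ Fin.natAdd 1)) =
      fun w => l (w 0) * a (Fin.tail w) := by
    ext w
    have e : ((w ∘ Fin.cast (add_comm 1 m)) ∘ Fin.natAdd 1) = Fin.tail w := by
      ext i
      simp only [Function.comp_apply, Fin.tail]
      congr 1
      ext
      simp
    rw [e]
    rfl
  rw [h3, ← hS]
  rw [hS', Nat.factorial_succ] at hsum
  have hm := factorial_cast_ne_zero m
  have hm1 : (m + 1 : ℂ) ≠ 0 := by exact_mod_cast m.succ_ne_zero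
  push_cast at hsum
  rw [mul_assoc] at hsum
  rw [mul_left_cancel₀ hm1 hsum]
  simp
  field_simp

end OneForm

/-! ### The graded ring of alternating forms -/

section GradedRing

open Equiv

variable {V : Type*} [NormedAddCommGroup V] [NormedSpace ℝ V] {m p q : ℕ}

variable (V) in
/-- The family of the spaces of complex-valued alternating forms on `V`, graded by the degree. -/
abbrev AltForm (m : ℕ) : Type _ := V [⋀^Fin m]→L[ℝ] ℂ

/-- Degrees such as (p + q) + r and p + (q + r) are equal but not by definition, so the ring axioms
have to be equalities of pairs of a degree and a form. -/
theorem sigma_altForm_ext (h : p = q) {a : AltForm V p} {b : AltForm V q}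
    (hab : ∀ v : Fin q → V, a (v ∘ Fin.cast h) = b v) :
    (⟨p, a⟩ : GradedMonoid (AltForm V)) = ⟨q, b⟩ := by
  subst h
  congr 1
  ext v
  exact hab v

instance altFormGMul : GradedMonoid.GMul (AltForm V) where
  mul a b := wedge a b

instance altFormGOne : GradedMonoid.GOne (AltForm V) where
  one := ContinuousAlternatingMap.constOfIsEmpty ℝ V (Fin 0) 1

instance altFormGRing : DirectSum.GRing (AltForm V) where
  mul_zero a := wedge_zero a
  zero_mul b := zero_wedge b
  mul_add a b c := wedge_add a b c
  add_mul a b c := add_wedge a b c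
  one_mul := fun ⟨p, a⟩ => Eq.symm <| sigma_altForm_ext (p := p) (q := 0 + p) (zero_add p).symm
    fun v => by
      have := constOfIsEmpty_wedge_apply a 1 (v ∘ Fin.cast (zero_add p).symm)
      rw [one_mul] at this
      exact this.symm
  mul_one := fun ⟨p, a⟩ => sigma_altForm_ext (p := p + 0) (q := p) rfl fun v => by
    have := wedge_constOfIsEmpty_apply a 1 v
    rw [one_mul] at this
    exact this
  mul_assoc := fun ⟨p, a⟩ ⟨q, b⟩ ⟨r, c⟩ =>
    sigma_altForm_ext (add_assoc p q r) fun v => wedge_assoc_apply a b c v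
  natCast k := ContinuousAlternatingMap.constOfIsEmpty ℝ V (Fin 0) k
  natCast_zero := by ext; simp
  natCast_succ k := by ext; simp; rfl
  intCast k := ContinuousAlternatingMap.constOfIsEmpty ℝ V (Fin 0) k
  intCast_ofNat k := by ext; simp
  intCast_negSucc_ofNat k := by ext; simp

variable (V) in
/-- The ring of (inhomogeneous) complex-valued alternating forms on `V`. -/
def FormRing : Type _ := DirectSum ℕ (AltForm V)

instance formRingRing : Ring (FormRing V) := DirectSum.ring (AltForm V)

/-- The class of a form in the graded ring. -/
def toRing : AltForm V m →+ FormRing V :=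
  let f : AltForm V m →+ DirectSum ℕ (AltForm V) := DirectSum.of (AltForm V) m
  { toFun := f
    map_zero' := map_zero f
    map_add' := map_add f }

/-- The component of degree `m` of an inhomogeneous form. -/
def FormRing.component (m : ℕ) : FormRing V →+ AltForm V m :=
  let f : DirectSum ℕ (AltForm V) →+ AltForm V m :=
    { toFun := fun x => x m
      map_zero' := rfl
      map_add' := fun _ _ => rfl }
  { toFun := f
    map_zero' := map_zero f
    map_add' := map_add f }

theorem component_toRing (a : AltForm V m) : FormRing.component m (toRing a) = a :=
  DirectSum.of_eq_same m a

theorem toRing_wedge (a : AltForm V p) (b : AltForm V q) :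
    toRing (wedge a b) = toRing a * toRing b :=
  (DirectSum.of_mul_of a b).symm

theorem toRing_congr (h : p = q) {a : AltForm V p} {b : AltForm V q}
    (hab : ∀ v : Fin q → V, a (v ∘ Fin.cast h) = b v) : toRing a = toRing b :=
  DirectSum.of_eq_of_gradedMonoid_eq (sigma_altForm_ext h hab)

theorem toRing_one : toRing (ContinuousAlternatingMap.constOfIsEmpty ℝ V (Fin 0) (1 : ℂ)) = 1 :=
  rfl

theorem toRing_swap_one (a : AltForm V m) (b : AltForm V 1) :
    toRing b * toRing a = (-1) ^ m * (toRing a * toRing b) := by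
  have key : toRing (wedge b a) = toRing (((-1 : ℤ) ^ m) • wedge a b) := by
    refine toRing_congr (add_comm 1 m) fun v => ?_
    rw [wedge_swap_apply]
    -- Moving a single entry past m others is a full rotation, of sign (-1)^m.
    have : (finAddFlip (m := m) (n := 1)).trans (finCongr (add_comm 1 m)) = finRotate (m + 1) :=
      rfl
    rw [this, sign_finRotate]
    simp
  rw [← toRing_wedge, ← toRing_wedge, key]
  rcases neg_one_pow_eq_or ℤ m with h | h
  · have h' : ((-1 : FormRing V) ^ m) = 1 := by
      simpa using congrArg (Int.cast (R := FormRing V)) h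
    rw [h, h', one_smul, one_mul]
  · have h' : ((-1 : FormRing V) ^ m) = -1 := by
      simpa using congrArg (Int.cast (R := FormRing V)) h
    rw [h, h', neg_one_smul, neg_one_mul]
    exact map_neg toRing _

theorem toRing_commute_two (a : AltForm V m) (b : AltForm V 2) :
    toRing b * toRing a = toRing a * toRing b := by
  rw [← toRing_wedge, ← toRing_wedge]
  refine toRing_congr (add_comm 2 m) fun v => ?_
  rw [wedge_swap_apply]
  -- Moving two entries is the square of a rotation, hence even.
  have : (finAddFlip (m := m) (n := 2)).trans (finCongr (add_comm 2 m)) =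
      (finRotate (m + 2)) ^ 2 := by
    ext i
    have h1 : ∀ j : Fin (m + 2), finRotate (m + 2) j = j + 1 := fun j => finRotate_apply j
    rw [pow_two, Perm.mul_apply, h1, h1]
    rcases lt_or_ge (i : ℕ) m with h | h
    · have := finAddFlip_apply_mk_left (m := m) (n := 2) h
      simp only [trans_apply, finCongr_apply, Fin.val_cast]
      rw [show i = ⟨(i : ℕ), _⟩ from rfl, this]
      simp only [Fin.val_add, Fin.val_one', Nat.mod_add_mod, Nat.add_mod_mod]
      rw [Nat.mod_eq_of_lt (by omega)]
      omega
    · have := finAddFlip_apply_mk_right (m := m) (n := 2) h i.2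
      simp only [trans_apply, finCongr_apply, Fin.val_cast]
      rw [show i = ⟨(i : ℕ), _⟩ from rfl, this]
      simp only [Fin.val_add, Fin.val_one', Nat.mod_add_mod, Nat.add_mod_mod]
      rw [Nat.mod_eq_sub_mod (by omega), Nat.mod_eq_of_lt (by omega)]
      omega
  rw [this]
  simp

theorem toRing_commute_of_two (b : AltForm V 2) (x : FormRing V) :
    Commute (toRing b) x := by
  induction x using DirectSum.induction_on with
  | zero => exact Commute.zero_right (toRing b)
  | of i a => exact toRing_commute_two a b
  | add x y hx hy =>
    exact Commute.add_right (R := FormRing V) hx hy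

/-- A real-linear function, as a 1-form. -/
def oneForm (l : V →L[ℝ] ℂ) : AltForm V 1 :=
  ContinuousAlternatingMap.ofSubsingleton ℝ V ℂ (0 : Fin 1) l

theorem toRing_alternatizeUncurryFin_smulRight (l : V →L[ℝ] ℂ) (a : AltForm V m) :
    toRing (ContinuousAlternatingMap.alternatizeUncurryFin (l.smulRight a)) =
      toRing (oneForm l) * toRing a := by
  rw [← toRing_wedge]
  refine (toRing_congr (add_comm 1 m) fun v => ?_).symm
  rw [oneForm, wedge_ofSubsingleton_apply]
  simp [ContinuousAlternatingMap.alternatizeUncurryFin_apply]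

/-- Alternating a linear map `L` amounts to forming `∑ᵢ eⁱ ∧ L eᵢ` for a basis `(eᵢ)` with dual
basis `(eⁱ)`. -/
theorem toRing_alternatizeUncurryFin [FiniteDimensional ℝ V] {ι : Type*} [Fintype ι]
    (b : Module.Basis ι ℝ V) (L : V →L[ℝ] AltForm V m) :
    toRing (ContinuousAlternatingMap.alternatizeUncurryFin L) =
      ∑ i, toRing (oneForm (Complex.ofRealCLM ∘L (b.coord i).toContinuousLinearMap)) *
        toRing (L (b i)) := by
  have hL : L = ∑ i, (Complex.ofRealCLM ∘L (b.coord i).toContinuousLinearMap).smulRight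
      (L (b i)) := by
    ext u v
    conv_lhs => rw [← b.sum_repr u, map_sum]
    simp [-Module.Basis.sum_repr]
  conv_lhs => rw [hL]
  rw [← ContinuousAlternatingMap.alternatizeUncurryFinCLM_apply, map_sum, map_sum]
  refine Finset.sum_congr rfl fun i _ => ?_
  rw [ContinuousAlternatingMap.alternatizeUncurryFinCLM_apply,
    toRing_alternatizeUncurryFin_smulRight]

attribute [irreducible] formRingRing

end GradedRing

/-! ### Continuity of the wedge product -/

section Continuity

variable {V : Type*} [NormedAddCommGroup V] [NormedSpace ℝ V] [FiniteDimensional ℝ V] {p q : ℕ}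

/-- In finite dimension the wedge product is automatically continuous, so the product rule for
continuous bilinear maps applies to it. -/
instance finiteDimensional_altForm : FiniteDimensional ℝ (V [⋀^Fin p]→L[ℝ] ℂ) := by
  let f : (V [⋀^Fin p]→L[ℝ] ℂ) →ₗ[ℝ] MultilinearMap ℝ (fun _ : Fin p => V) ℂ :=
    { toFun := fun a => a.toAlternatingMap.toMultilinearMap
      map_add' := fun _ _ => rfl
      map_smul' := fun _ _ => rfl }
  refine Module.Finite.of_injective f fun a b h => ?_
  ext v
  exact congrArg (fun g : MultilinearMap ℝ (fun _ : Fin p => V) ℂ => g v) h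

omit [FiniteDimensional ℝ V] in
theorem ofReal_smul_altForm (c : ℝ) (a : V [⋀^Fin p]→L[ℝ] ℂ) : (c : ℂ) • a = c • a := by
  ext v
  simp

/-- The wedge product as a continuous bilinear map. -/
def wedgeCLM (V : Type*) [NormedAddCommGroup V] [NormedSpace ℝ V] [FiniteDimensional ℝ V]
    (p q : ℕ) :
    (V [⋀^Fin p]→L[ℝ] ℂ) →L[ℝ] (V [⋀^Fin q]→L[ℝ] ℂ) →L[ℝ] (V [⋀^Fin (p + q)]→L[ℝ] ℂ) :=
  LinearMap.toContinuousBilinearMap (LinearMap.mk₂ ℝ (fun a b => wedge a b)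
    (fun a b c => add_wedge a b c)
    (fun c a b => by
      simpa only [ofReal_smul_altForm] using smul_wedge (c : ℂ) a b)
    (fun a b c => wedge_add a b c)
    (fun c a b => by
      simpa only [ofReal_smul_altForm] using wedge_smul (c : ℂ) a b))

theorem wedgeCLM_apply (a : V [⋀^Fin p]→L[ℝ] ℂ) (b : V [⋀^Fin q]→L[ℝ] ℂ) :
    wedgeCLM V p q a b = wedge a b := rfl

end Continuity

/-! ### Local calculus of `∂` and `∂̄` -/

section LocalCalculus

variable {n m p q : ℕ}

/-- The part `(L + κ L ∘ i) / 2` of a real-linear map `L`; it is the complex-linear part for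
`κ = -i` and the conjugate-linear part for `κ = i`. -/
def linearPart (κ : ℂ) (L : (Fin n → ℂ) →L[ℝ] AltForm (Fin n → ℂ) m) :
    (Fin n → ℂ) →L[ℝ] AltForm (Fin n → ℂ) m :=
  (2⁻¹ : ℂ) • (L + κ • L.comp (mulI n))

theorem linearPart_apply (κ : ℂ) (L : (Fin n → ℂ) →L[ℝ] AltForm (Fin n → ℂ) m)
    (u : Fin n → ℂ) : linearPart κ L u = (2⁻¹ : ℂ) • (L u + κ • L (mulI n u)) := rfl

/-- The common form of the operators `∂` (for `κ = -i`) and `∂̄` (for `κ = i`) on `ℂⁿ`. -/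
def dLocal (κ : ℂ) (α : (Fin n → ℂ) → AltForm (Fin n → ℂ) m) (z : Fin n → ℂ) :
    AltForm (Fin n → ℂ) (m + 1) :=
  .alternatizeUncurryFin (linearPart κ (fderiv ℝ α z))

theorem delLocal_eq (α : (Fin n → ℂ) → AltForm (Fin n → ℂ) m) :
    delLocal α = dLocal (-Complex.I) α := by
  ext1 z
  rw [delLocal, dLocal]
  congr 1
  ext1 u
  change (2⁻¹ : ℂ) • (fderiv ℝ α z u - Complex.I • fderiv ℝ α z (mulI n u)) = _
  rw [linearPart_apply]
  ext v
  simp [sub_eq_add_neg]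

theorem dLocal_congr {κ : ℂ} {α β : (Fin n → ℂ) → AltForm (Fin n → ℂ) m} {z : Fin n → ℂ}
    (h : α =ᶠ[nhds z] β) : dLocal κ α z = dLocal κ β z := by
  rw [dLocal, dLocal, h.fderiv_eq]

theorem linearPart_add (κ : ℂ) (L L' : (Fin n → ℂ) →L[ℝ] AltForm (Fin n → ℂ) m) :
    linearPart κ (L + L') = linearPart κ L + linearPart κ L' := by
  ext1 u
  simp only [linearPart_apply, add_apply, smul_add]
  abel

theorem dLocal_sum {ι : Type*} (s : Finset ι) (κ : ℂ)
    (α : ι → (Fin n → ℂ) → AltForm (Fin n → ℂ) m) (z : Fin n → ℂ)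
    (h : ∀ i ∈ s, DifferentiableAt ℝ (α i) z) :
    dLocal κ (fun w => ∑ i ∈ s, α i w) z = ∑ i ∈ s, dLocal κ (α i) z := by
  have h2 : linearPart κ (∑ i ∈ s, fderiv ℝ (α i) z) =
      ∑ i ∈ s, linearPart κ (fderiv ℝ (α i) z) := by
    ext1 u
    simp only [linearPart_apply, sum_apply, Finset.smul_sum,
      ← Finset.sum_add_distrib]
  simp only [dLocal]
  rw [fderiv_fun_sum h, h2, ← ContinuousAlternatingMap.alternatizeUncurryFinCLM_apply, map_sum]
  rfl

/-- Taking the linear part preserves the product rule. Alternation is Σ eⁱ ∧ (derivative along eᵢ),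
and moving eⁱ past α costs (-1)^p. -/
theorem toRing_dLocal_wedge (κ : ℂ) {α : (Fin n → ℂ) → AltForm (Fin n → ℂ) p}
    {β : (Fin n → ℂ) → AltForm (Fin n → ℂ) q} {z : Fin n → ℂ}
    (hα : DifferentiableAt ℝ α z) (hβ : DifferentiableAt ℝ β z) :
    toRing (dLocal κ (fun w => wedge (α w) (β w)) z) =
      toRing (dLocal κ α z) * toRing (β z) +
        (-1) ^ p * toRing (α z) * toRing (dLocal κ β z) := by
  have hD (u : Fin n → ℂ) : fderiv ℝ (fun w => wedge (α w) (β w)) z u =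
      wedge (fderiv ℝ α z u) (β z) + wedge (α z) (fderiv ℝ β z u) := by
    have := ((wedgeCLM (Fin n → ℂ) p q).hasFDerivAt_of_bilinear hα.hasFDerivAt
      hβ.hasFDerivAt).fderiv
    change fderiv ℝ (fun w => wedgeCLM (Fin n → ℂ) p q (α w) (β w)) z u = _
    rw [this]
    simp [wedgeCLM_apply, add_comm]
  have hP (u : Fin n → ℂ) : linearPart κ (fderiv ℝ (fun w => wedge (α w) (β w)) z) u =
      wedge (linearPart κ (fderiv ℝ α z) u) (β z) +
        wedge (α z) (linearPart κ (fderiv ℝ β z) u) := by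
    simp only [linearPart_apply, hD, smul_wedge, wedge_smul, add_wedge, wedge_add, smul_add]
    abel
  let b := Module.finBasis ℝ (Fin n → ℂ)
  simp only [dLocal, toRing_alternatizeUncurryFin b, hP, map_add, toRing_wedge, mul_add,
    Finset.sum_add_distrib, Finset.sum_mul, Finset.mul_sum]
  congr 1
  · exact Finset.sum_congr rfl fun i _ => by rw [mul_assoc]
  · refine Finset.sum_congr rfl fun i _ => ?_
    rw [← mul_assoc, toRing_swap_one]
    simp only [mul_assoc]

theorem contDiffOn_wedge {α : (Fin n → ℂ) → AltForm (Fin n → ℂ) p}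
    {β : (Fin n → ℂ) → AltForm (Fin n → ℂ) q} {s : Set (Fin n → ℂ)}
    (hα : ContDiffOn ℝ ∞ α s) (hβ : ContDiffOn ℝ ∞ β s) :
    ContDiffOn ℝ ∞ (fun w => wedge (α w) (β w)) s := by
  have h0 : ContDiff ℝ ∞ (fun a => wedgeCLM (Fin n → ℂ) p q a) :=
    ContinuousLinearMap.contDiff _
  have h : ContDiffOn ℝ ∞ (fun w => wedgeCLM (Fin n → ℂ) p q (α w)) s :=
    h0.comp_contDiffOn hα
  exact h.clm_apply hβ

theorem contDiffOn_dLocal (κ : ℂ) {α : (Fin n → ℂ) → AltForm (Fin n → ℂ) m}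
    {s : Set (Fin n → ℂ)} (hs : IsOpen s) (hα : ContDiffOn ℝ ∞ α s) :
    ContDiffOn ℝ ∞ (dLocal κ α) s := by
  have h1 : ContDiffOn ℝ ∞ (fderiv ℝ α) s := hα.fderiv_of_isOpen hs (by norm_cast)
  have h2 : ContDiffOn ℝ ∞ (fun z => linearPart κ (fderiv ℝ α z)) s := by
    have h3 : ContDiffOn ℝ ∞ (fun z => (fderiv ℝ α z).comp (mulI n)) s :=
      h1.clm_comp contDiffOn_const
    exact ContDiffOn.const_smul (2⁻¹ : ℂ) (h1.add (ContDiffOn.const_smul κ h3))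
  exact (ContinuousAlternatingMap.alternatizeUncurryFinCLM ℝ (Fin n → ℂ) ℂ).contDiff.comp_contDiffOn
    h2

/-- `∂` and `∂̄` commute with the pullback under a holomorphic map. -/
theorem dLocal_pullback (κ : ℂ) {η : (Fin n → ℂ) → AltForm (Fin n → ℂ) m}
    {f : (Fin n → ℂ) → Fin n → ℂ} {z : Fin n → ℂ}
    (hη : DifferentiableAt ℝ η (f z)) (hf : ContDiffAt ℝ ∞ f z)
    (hol : ∀ᶠ w in nhds z, ∀ v, fderiv ℝ f w (mulI n v) = mulI n (fderiv ℝ f w v)) :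
    dLocal κ (fun w => (η (f w)).compContinuousLinearMap (fderiv ℝ f w)) z =
      (dLocal κ η (f z)).compContinuousLinearMap (fderiv ℝ f z) := by
  have hdf : DifferentiableAt ℝ f z := hf.differentiableAt (by norm_num)
  have hd2f : DifferentiableAt ℝ (fderiv ℝ f) z :=
    (hf.fderiv_right (m := 1) (by norm_cast)).differentiableAt one_ne_zero
  have hsymm : ∀ u v, fderiv ℝ (fderiv ℝ f) z u v = fderiv ℝ (fderiv ℝ f) z v u :=
    hf.isSymmSndFDerivAt (by simpa using ENat.LEInfty.out)
  -- Differentiating the complex linearity of Df shows that D²f is complex linear in its second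
  -- argument.
  have hJ (u v : Fin n → ℂ) : fderiv ℝ (fderiv ℝ f) z u (mulI n v) =
      mulI n (fderiv ℝ (fderiv ℝ f) z u v) := by
    have e1 : HasFDerivAt (fun w => fderiv ℝ f w (mulI n v))
        ((fderiv ℝ (fderiv ℝ f) z).flip (mulI n v)) z := by
      simpa using hd2f.hasFDerivAt.clm_apply (hasFDerivAt_const (mulI n v) z)
    have e2 : HasFDerivAt (fun w => mulI n (fderiv ℝ f w v))
        ((mulI n).comp ((fderiv ℝ (fderiv ℝ f) z).flip v)) z := by
      refine (mulI n).hasFDerivAt.comp z ?_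
      simpa using hd2f.hasFDerivAt.clm_apply (hasFDerivAt_const v z)
    have e3 := e1.unique (e2.congr_of_eventuallyEq (hol.mono fun w hw => hw v))
    exact congrArg (fun l : (Fin n → ℂ) →L[ℝ] (Fin n → ℂ) => l u) e3
  have hol' := hol.self_of_nhds
  set H := fderiv ℝ (fderiv ℝ f) z
  -- D²f is symmetric and complex linear in one argument, hence in both, so inserting i in the first
  -- keeps it symmetric.
  have hsymm' : ∀ u v, (H.comp (mulI n)) u v = (H.comp (mulI n)) v u := by
    intro u v
    simp only [ContinuousLinearMap.comp_apply]
    rw [hsymm, hJ, hsymm v u, ← hJ, hsymm]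
  set A := ContinuousAlternatingMap.alternatizeUncurryFinCLM (n := m) ℝ (Fin n → ℂ) ℂ
  set D := fderiv ℝ f z
  -- The derivative of the pullback splits into L₁, which differentiates η, and L₂, which
  -- differentiates Df.
  set L₁ : (Fin n → ℂ) →L[ℝ] AltForm (Fin n → ℂ) m :=
    (ContinuousAlternatingMap.compContinuousLinearMapCLM D).comp ((fderiv ℝ η (f z)).comp D)
    with hL₁
  set L₂ : (Fin n → ℂ) →L[ℝ] AltForm (Fin n → ℂ) m :=
    ((η (f z)).fderivCompContinuousLinearMap D).comp H with hL₂
  have hfd : fderiv ℝ (fun w => (η (f w)).compContinuousLinearMap (fderiv ℝ f w)) z =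
      L₁ + L₂ := by
    rw [fderiv_continuousAlternatingMapCompContinuousLinearMap (by exact hη.comp z hdf) hd2f,
      fderiv_fun_comp _ hη hdf]
  have h2 : linearPart κ L₂ = (2⁻¹ : ℂ) • L₂ + (2⁻¹ * κ) • L₂.comp (mulI n) := by
    ext u v
    simp [linearPart_apply]
    ring
  -- L₂ and L₂ ∘ i both contain a symmetric second derivative, which alternation kills.
  have hA2 : A (linearPart κ L₂) = 0 := by
    have e1 : A L₂ = 0 :=
      ContinuousAlternatingMap.alternatizeUncurryFin_fderivCompContinuousLinearMap_eq_zero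
        _ _ hsymm
    have e2 : A (L₂.comp (mulI n)) = 0 :=
      ContinuousAlternatingMap.alternatizeUncurryFin_fderivCompContinuousLinearMap_eq_zero
        _ _ hsymm'
    have hs (c : ℂ) (L : (Fin n → ℂ) →L[ℝ] AltForm (Fin n → ℂ) m) : A (c • L) = c • A L :=
      ContinuousAlternatingMap.alternatizeUncurryFin_smul c L
    rw [h2, map_add, hs, hs, e1, e2, smul_zero, smul_zero, add_zero]
  change A (linearPart κ _) = _
  rw [hfd, linearPart_add, map_add, hA2, add_zero]
  ext v
  simp [A, dLocal, ContinuousAlternatingMap.alternatizeUncurryFin_apply, linearPart_apply, hL₁,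
    hol', Function.comp_def, D]
  rfl

theorem integrable_fderiv_apply {f : (Fin n → ℂ) → ℂ} (hf : ContDiff ℝ 1 f)
    (hc : HasCompactSupport f) (u : Fin n → ℂ) :
    MeasureTheory.Integrable (fun z => fderiv ℝ f z u) :=
  ((hf.continuous_fderiv one_ne_zero).clm_apply continuous_const).integrable_of_hasCompactSupport
    (hc.fderiv_apply ℝ u)

/-- Integration by parts against the constant 1; only the products need to be integrable. -/
theorem integral_fderiv_apply_eq_zero {f : (Fin n → ℂ) → ℂ} (hf : ContDiff ℝ 1 f)
    (hc : HasCompactSupport f) (u : Fin n → ℂ) : ∫ z, fderiv ℝ f z u = 0 := by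
  have h := integral_mul_fderiv_eq_neg_fderiv_mul_of_integrable
    (μ := (MeasureTheory.volume : MeasureTheory.Measure (Fin n → ℂ)))
    (f := fun _ => (1 : ℂ)) (g := f) (v := u) (by simp)
    (by simpa using integrable_fderiv_apply hf hc u)
    (by simpa using hf.continuous.integrable_of_hasCompactSupport hc)
    (fun x _ => differentiableAt_const _) (fun x _ => (hf.differentiable one_ne_zero) x)
  simpa using h

/-- Stokes' theorem for the operators `∂` and `∂̄` and forms with compact support in `ℂⁿ`. -/
theorem integral_dLocal_eq_zero (κ : ℂ) {η : (Fin n → ℂ) → AltForm (Fin n → ℂ) m}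
    (hη : ContDiff ℝ 1 η) (hc : HasCompactSupport η) (w : Fin (m + 1) → Fin n → ℂ) :
    ∫ z, dLocal κ η z w = 0 := by
  have hev (v : Fin m → Fin n → ℂ) : ContDiff ℝ 1 (fun z => η z v) :=
    (ContinuousAlternatingMap.apply ℝ (Fin n → ℂ) ℂ v).contDiff.comp hη
  have hcv (v : Fin m → Fin n → ℂ) : HasCompactSupport (fun z => η z v) :=
    hc.comp_left (g := fun a : AltForm (Fin n → ℂ) m => a v) rfl
  have hfd (v : Fin m → Fin n → ℂ) (z u : Fin n → ℂ) :
      fderiv ℝ η z u v = fderiv ℝ (fun z => η z v) z u :=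
    (fderiv_continuousAlternatingMap_apply_const_apply
      ((hη.differentiable one_ne_zero) z) v u).symm
  -- On the fixed frame w the form is a constant-coefficient combination of directional derivatives
  -- of compactly supported functions.
  have hz (z : Fin n → ℂ) : dLocal κ η z w = ∑ i : Fin (m + 1), (-1) ^ (i : ℕ) *
      (2⁻¹ * (fderiv ℝ (fun z => η z (i.removeNth w)) z (w i) +
        κ * fderiv ℝ (fun z => η z (i.removeNth w)) z (mulI n (w i)))) := by
    simp [dLocal, ContinuousAlternatingMap.alternatizeUncurryFin_apply, linearPart_apply, hfd, mul_add]
  simp only [hz]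
  have hint (i : Fin (m + 1)) (u : Fin n → ℂ) :=
    integrable_fderiv_apply (hev (i.removeNth w)) (hcv _) u
  rw [MeasureTheory.integral_finsetSum]
  · refine Finset.sum_eq_zero fun i _ => ?_
    rw [MeasureTheory.integral_const_mul, MeasureTheory.integral_const_mul,
      MeasureTheory.integral_add (hint i _) ((hint i _).const_mul κ),
      MeasureTheory.integral_const_mul,
      integral_fderiv_apply_eq_zero (hev _) (hcv _), integral_fderiv_apply_eq_zero (hev _) (hcv _)]
    simp
  · exact fun i _ => (((hint i _).add ((hint i _).const_mul κ)).const_mul _).const_mul _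

end LocalCalculus

/-! ### Change of holomorphic charts -/

section Charts

variable {n m p q : ℕ} {X : Type*} [TopologicalSpace X] [ChartedSpace (Fin n → ℂ) X]

variable (n) in
/-- The transition map from the chart at `c` to the chart at `y`. -/
def transition (c y : X) : OpenPartialHomeomorph (Fin n → ℂ) (Fin n → ℂ) :=
  (chartAt (Fin n → ℂ) c).symm.trans (chartAt (Fin n → ℂ) y)

theorem mem_transition_source {c y : X} {z : Fin n → ℂ} :
    z ∈ (transition n c y).source ↔ z ∈ (chartAt (Fin n → ℂ) c).target ∧
      (chartAt (Fin n → ℂ) c).symm z ∈ (chartAt (Fin n → ℂ) y).source := by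
  simp [transition]

theorem transition_apply (c y : X) (z : Fin n → ℂ) :
    transition n c y z = chartAt (Fin n → ℂ) y ((chartAt (Fin n → ℂ) c).symm z) := rfl

theorem transition_mem_target {c y : X} {z : Fin n → ℂ} (hz : z ∈ (transition n c y).source) :
    transition n c y z ∈ (chartAt (Fin n → ℂ) y).target :=
  (chartAt (Fin n → ℂ) y).map_source (mem_transition_source.1 hz).2

theorem chartAt_symm_transition {c y : X} {z : Fin n → ℂ} (hz : z ∈ (transition n c y).source) :
    (chartAt (Fin n → ℂ) y).symm (transition n c y z) = (chartAt (Fin n → ℂ) c).symm z :=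
  (chartAt (Fin n → ℂ) y).left_inv (mem_transition_source.1 hz).2

theorem mem_transition_self_source {c : X} {z : Fin n → ℂ}
    (hz : z ∈ (chartAt (Fin n → ℂ) c).target) :
    z ∈ (transition n c ((chartAt (Fin n → ℂ) c).symm z)).source :=
  mem_transition_source.2 ⟨hz, mem_chart_source _ _⟩

theorem fderiv_transition_self (x : X) :
    fderiv ℝ (transition n x x) (chartAt (Fin n → ℂ) x x) =
      ContinuousLinearMap.id ℝ (Fin n → ℂ) := by
  rw [← fderiv_id (𝕜 := ℝ) (x := chartAt (Fin n → ℂ) x x)]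
  refine Filter.EventuallyEq.fderiv_eq ?_
  filter_upwards [(chartAt (Fin n → ℂ) x).open_target.mem_nhds (mem_chart_target _ x)] with w hw
  exact (chartAt (Fin n → ℂ) x).right_inv hw

section Holomorphic

variable [IsManifold 𝓘(ℂ, Fin n → ℂ) ω X]

theorem contDiffOn_transition_complex (c y : X) :
    ContDiffOn ℂ ω (transition n c y) (transition n c y).source := by
  have := (contDiffGroupoid ω 𝓘(ℂ, Fin n → ℂ)).compatible (chart_mem_atlas (Fin n → ℂ) c)
    (chart_mem_atlas (Fin n → ℂ) y)
  rw [contDiffGroupoid, mem_groupoid_of_pregroupoid] at this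
  simpa [contDiffPregroupoid, transition] using this.1

theorem contDiffOn_transition (c y : X) :
    ContDiffOn ℝ ∞ (transition n c y) (transition n c y).source :=
  ((contDiffOn_transition_complex c y).restrict_scalars ℝ).of_le le_top

theorem contDiffAt_transition {c y : X} {z : Fin n → ℂ} (hz : z ∈ (transition n c y).source) :
    ContDiffAt ℝ ∞ (transition n c y) z :=
  (contDiffOn_transition c y).contDiffAt ((transition n c y).open_source.mem_nhds hz)

theorem differentiableAt_transition {c y : X} {z : Fin n → ℂ}
    (hz : z ∈ (transition n c y).source) : DifferentiableAt ℝ (transition n c y) z :=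
  (contDiffAt_transition hz).differentiableAt (by norm_num)

theorem fderiv_transition {c y : X} {z : Fin n → ℂ} (hz : z ∈ (transition n c y).source) :
    fderiv ℝ (transition n c y) z =
      (fderiv ℂ (transition n c y) z).restrictScalars ℝ := by
  have h : DifferentiableAt ℂ (transition n c y) z :=
    ((contDiffOn_transition_complex c y).contDiffAt
      ((transition n c y).open_source.mem_nhds hz)).differentiableAt (by simp)
  exact (h.hasFDerivAt.restrictScalars ℝ).fderiv

theorem fderiv_transition_mulI {c y : X} {z : Fin n → ℂ} (hz : z ∈ (transition n c y).source)
    (v : Fin n → ℂ) :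
    fderiv ℝ (transition n c y) z (mulI n v) = mulI n (fderiv ℝ (transition n c y) z v) := by
  rw [fderiv_transition hz]
  change fderiv ℂ (transition n c y) z (Complex.I • v) =
    Complex.I • fderiv ℂ (transition n c y) z v
  exact map_smul _ _ _

/-- The real determinant of a complex-linear map is |det|² of its complex determinant: holomorphic
charts are compatibly oriented. -/
theorem det_fderiv_transition_nonneg {c y : X} {z : Fin n → ℂ}
    (hz : z ∈ (transition n c y).source) : 0 ≤ (fderiv ℝ (transition n c y) z).det := by
  rw [fderiv_transition hz, ContinuousLinearMap.det]
  have : (((fderiv ℂ (transition n c y) z).restrictScalars ℝ : (Fin n → ℂ) →L[ℝ] (Fin n → ℂ)) :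
      (Fin n → ℂ) →ₗ[ℝ] (Fin n → ℂ)) =
      ((fderiv ℂ (transition n c y) z : (Fin n → ℂ) →L[ℂ] (Fin n → ℂ)) :
        (Fin n → ℂ) →ₗ[ℂ] (Fin n → ℂ)).restrictScalars ℝ := rfl
  rw [this, LinearMap.det_restrictScalars, Algebra.norm_complex_apply]
  exact Complex.normSq_nonneg _

theorem fderiv_transition_comp {c y x : X} {z : Fin n → ℂ}
    (hz : z ∈ (transition n c y).source) (hx : z ∈ (transition n c x).source) :
    (fderiv ℝ (transition n y x) (transition n c y z)).comp (fderiv ℝ (transition n c y) z) =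
      fderiv ℝ (transition n c x) z := by
  have hy : transition n c y z ∈ (transition n y x).source := by
    refine mem_transition_source.2 ⟨transition_mem_target hz, ?_⟩
    rw [chartAt_symm_transition hz]
    exact (mem_transition_source.1 hx).2
  rw [← fderiv_comp _ (differentiableAt_transition hy) (differentiableAt_transition hz)]
  refine Filter.EventuallyEq.fderiv_eq ?_
  filter_upwards [(transition n c y).open_source.mem_nhds hz] with w hw
  rw [Function.comp_apply, transition_apply y x, chartAt_symm_transition hw]
  rfl

/-- The tangent space at x is identified with ℂⁿ by the chart at x, so the target chart of the
transition map depends on z. -/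
theorem mfderiv_chartAt_symm {c : X} {z : Fin n → ℂ}
    (hz : z ∈ (chartAt (Fin n → ℂ) c).target) :
    mfderiv 𝓘(ℝ, Fin n → ℂ) 𝓘(ℝ, Fin n → ℂ) (chartAt (Fin n → ℂ) c).symm z =
      fderiv ℝ (transition n c ((chartAt (Fin n → ℂ) c).symm z)) z := by
  have h : MDifferentiableAt 𝓘(ℝ, Fin n → ℂ) 𝓘(ℝ, Fin n → ℂ) (chartAt (Fin n → ℂ) c).symm z :=
    haveI : IsManifold 𝓘(ℝ, Fin n → ℂ) 1 X := IsManifold.of_le (n := ∞) (by norm_cast)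
    mdifferentiableAt_atlas_symm (chart_mem_atlas _ c) hz
  refine h.mfderiv.trans ?_
  simp only [mfld_simps, fderivWithin_univ]
  rfl

theorem mfderiv_chartAt_self (x : X) :
    mfderiv 𝓘(ℝ, Fin n → ℂ) 𝓘(ℝ, Fin n → ℂ) (chartAt (Fin n → ℂ) x) x =
      ContinuousLinearMap.id ℝ (Fin n → ℂ) := by
  have h : MDifferentiableAt 𝓘(ℝ, Fin n → ℂ) 𝓘(ℝ, Fin n → ℂ) (chartAt (Fin n → ℂ) x) x :=
    haveI : IsManifold 𝓘(ℝ, Fin n → ℂ) 1 X := IsManifold.of_le (n := ∞) (by norm_cast)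
    mdifferentiableAt_atlas (chart_mem_atlas _ x) (mem_chart_source _ x)
  refine h.mfderiv.trans ?_
  simp only [mfld_simps, fderivWithin_univ]
  exact fderiv_transition_self x

end Holomorphic

end Charts

/-! ### Forms in charts -/

namespace Form

variable {n m p q : ℕ} {X : Type*} [TopologicalSpace X] [ChartedSpace (Fin n → ℂ) X]

/-- The value of a form at a point, as an alternating form on `ℂⁿ`. -/
def value (α : Form n X m) (x : X) : AltForm (Fin n → ℂ) m := α x

/-- The common form of the operators `∂` (for `κ = -i`) and `∂̄` (for `κ = i`). -/
def diff (κ : ℂ) (α : Form n X m) : Form n X (m + 1) := fun x =>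
  (dLocal κ (α.inChart x) (chartAt (Fin n → ℂ) x x)).compContinuousLinearMap
    (mfderiv 𝓘(ℝ, Fin n → ℂ) 𝓘(ℝ, Fin n → ℂ) (chartAt (Fin n → ℂ) x) x)

theorem del_eq_diff (α : Form n X m) : α.del = α.diff (-Complex.I) := by
  ext1 x
  rw [del, delLocal_eq]
  rfl

theorem delbar_eq_diff (α : Form n X m) : α.delbar = α.diff Complex.I := rfl

theorem inChart_wedge (α : Form n X p) (β : Form n X q) (c : X) (z : Fin n → ℂ) :
    (α.wedge β).inChart c z = ComplexManifold.wedge (α.inChart c z) (β.inChart c z) :=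
  wedge_compContinuousLinearMap _ _ _

theorem value_wedge (α : Form n X p) (β : Form n X q) (x : X) :
    (α.wedge β).value x = ComplexManifold.wedge (α.value x) (β.value x) := rfl

/-- A form is smooth if it is smooth in all the charts. -/
def IsSmooth (α : Form n X m) : Prop :=
  ∀ c : X, ContDiffOn ℝ ∞ (α.inChart c) (chartAt (Fin n → ℂ) c).target

theorem IsSmooth.wedge {α : Form n X p} {β : Form n X q} (hα : α.IsSmooth) (hβ : β.IsSmooth) :
    (α.wedge β).IsSmooth := fun c =>
  (contDiffOn_wedge (hα c) (hβ c)).congr fun z _ => inChart_wedge α β c z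

theorem IsSmooth.differentiableAt {α : Form n X m} (hα : α.IsSmooth) {c : X} {z : Fin n → ℂ}
    (hz : z ∈ (chartAt (Fin n → ℂ) c).target) : DifferentiableAt ℝ (α.inChart c) z :=
  ((hα c).contDiffAt ((chartAt (Fin n → ℂ) c).open_target.mem_nhds hz)).differentiableAt
    (by norm_num)

variable [IsManifold 𝓘(ℂ, Fin n → ℂ) ω X]

theorem inChart_eq (α : Form n X m) {c x : X} {z : Fin n → ℂ}
    (hz : z ∈ (chartAt (Fin n → ℂ) c).target) (hx : (chartAt (Fin n → ℂ) c).symm z = x) :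
    α.inChart c z = (α.value x).compContinuousLinearMap (fderiv ℝ (transition n c x) z) := by
  subst hx
  rw [inChart, mfderiv_chartAt_symm hz]
  rfl

theorem inChart_self (α : Form n X m) (x : X) :
    α.inChart x (chartAt (Fin n → ℂ) x x) = α.value x := by
  have hx : (chartAt (Fin n → ℂ) x).symm (chartAt (Fin n → ℂ) x x) = x :=
    (chartAt (Fin n → ℂ) x).left_inv (mem_chart_source _ x)
  rw [inChart_eq α (mem_chart_target _ x) hx]
  rw [fderiv_transition_self]
  rfl

theorem value_diff (κ : ℂ) (α : Form n X m) (x : X) :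
    (α.diff κ).value x = dLocal κ (α.inChart x) (chartAt (Fin n → ℂ) x x) := by
  rw [value, diff, mfderiv_chartAt_self]
  rfl

theorem inChart_eq_pullback (α : Form n X m) {c y : X} {z : Fin n → ℂ}
    (hz : z ∈ (transition n c y).source) :
    α.inChart c z = (α.inChart y (transition n c y z)).compContinuousLinearMap
      (fderiv ℝ (transition n c y) z) := by
  have hzc := (mem_transition_source.1 hz).1
  rw [inChart_eq α hzc rfl, inChart_eq α (transition_mem_target hz) (chartAt_symm_transition hz),
    ← fderiv_transition_comp hz (mem_transition_self_source hzc)]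
  rfl

/-- `∂` and `∂̄` can be computed in an arbitrary chart. -/
theorem inChart_diff (κ : ℂ) {α : Form n X m} (hα : α.IsSmooth) {c : X} {z : Fin n → ℂ}
    (hz : z ∈ (chartAt (Fin n → ℂ) c).target) :
    (α.diff κ).inChart c z = dLocal κ (α.inChart c) z := by
  have hs := mem_transition_self_source hz
  -- The left side is computed in the chart at the point below z; pulling back along the holomorphic
  -- transition map carries it to the chart at c.
  rw [inChart_eq _ hz rfl, value_diff, ← transition_apply, ← dLocal_pullback]
  · refine (dLocal_congr ?_).symm
    filter_upwards [(transition n c _).open_source.mem_nhds hs] with w hw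
    exact inChart_eq_pullback α hw
  · exact hα.differentiableAt (transition_mem_target hs)
  · exact contDiffAt_transition hs
  · filter_upwards [(transition n c _).open_source.mem_nhds hs] with w hw
    exact fderiv_transition_mulI hw

theorem IsSmooth.diff (κ : ℂ) {α : Form n X m} (hα : α.IsSmooth) : (α.diff κ).IsSmooth :=
  fun c => (contDiffOn_dLocal κ (chartAt (Fin n → ℂ) c).open_target (hα c)).congr
    fun _ hz => inChart_diff κ hα hz

theorem toRing_diff_wedge (κ : ℂ) {α : Form n X p} {β : Form n X q} (hα : α.IsSmooth)
    (hβ : β.IsSmooth) (x : X) :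
    toRing (((α.wedge β).diff κ).value x) =
      toRing ((α.diff κ).value x) * toRing (β.value x) +
        (-1) ^ p * toRing (α.value x) * toRing ((β.diff κ).value x) := by
  rw [value_diff, value_diff, value_diff, ← inChart_self α, ← inChart_self β,
    ← toRing_dLocal_wedge κ (hα.differentiableAt (mem_chart_target _ x))
      (hβ.differentiableAt (mem_chart_target _ x))]
  congr 2
  ext1 z
  exact inChart_wedge α β x z

end Form

/-! ### Smoothness of the fundamental form -/

section EvalSmooth

variable {V E : Type*} [NormedAddCommGroup V] [NormedSpace ℝ V] [FiniteDimensional ℝ V]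
  [NormedAddCommGroup E] [NormedSpace ℝ E] {m : ℕ}

/-- A form is recovered linearly from its values on tuples of basis vectors, through a left inverse
S of the evaluation map T. -/
theorem contDiffOn_altForm {f : E → AltForm V m} {s : Set E}
    (h : ∀ v : Fin m → V, ContDiffOn ℝ ∞ (fun z => f z v) s) : ContDiffOn ℝ ∞ f s := by
  let b := Module.finBasis ℝ V
  let T : AltForm V m →ₗ[ℝ] ((Fin m → Fin (Module.finrank ℝ V)) → ℂ) :=
    { toFun := fun a i => a (b ∘ i)
      map_add' := fun _ _ => rfl
      map_smul' := fun _ _ => rfl }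
  have hT : Function.Injective T := by
    intro a a' haa
    apply ContinuousAlternatingMap.toAlternatingMap_injective
    refine AlternatingMap.coe_multilinearMap_injective ?_
    exact Module.Basis.ext_multilinear (fun _ => b) fun i => congrFun haa i
  obtain ⟨S, hS⟩ := LinearMap.exists_leftInverse_of_injective T (LinearMap.ker_eq_bot.2 hT)
  have hf : f = fun z => S.toContinuousLinearMap (fun i => f z (b ∘ i)) := by
    ext1 z
    exact (LinearMap.congr_fun hS (f z)).symm
  rw [hf]
  exact S.toContinuousLinearMap.contDiff.comp_contDiffOn (contDiffOn_pi.2 fun i => h _)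

end EvalSmooth

section FundamentalForm

variable {n : ℕ} {X : Type*} [TopologicalSpace X] [ChartedSpace (Fin n → ℂ) X]
  [IsManifold 𝓘(ℂ, Fin n → ℂ) ω X]

open Bundle

/-- A coordinate vector field is the tangent map of the inverse chart applied to a constant field;
as a smooth section it can be paired with the bundle metric. -/
theorem contMDiffOn_mfderiv_chartAt_symm (c : X) (u : Fin n → ℂ) :
    ContMDiffOn 𝓘(ℝ, Fin n → ℂ) (𝓘(ℝ, Fin n → ℂ).prod 𝓘(ℝ, Fin n → ℂ)) ∞
      (fun z => TotalSpace.mk' (Fin n → ℂ) (E := fun x : X => TangentSpace 𝓘(ℝ, Fin n → ℂ) x)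
        ((chartAt (Fin n → ℂ) c).symm z)
        (mfderiv 𝓘(ℝ, Fin n → ℂ) 𝓘(ℝ, Fin n → ℂ) (chartAt (Fin n → ℂ) c).symm z u))
      (chartAt (Fin n → ℂ) c).target := by
  have ho := (chartAt (Fin n → ℂ) c).open_target
  have h1 : ContMDiffOn 𝓘(ℝ, Fin n → ℂ) 𝓘(ℝ, Fin n → ℂ) ∞ (chartAt (Fin n → ℂ) c).symm
      (chartAt (Fin n → ℂ) c).target := contMDiffOn_chart_symm
  have h2 := h1.contMDiffOn_tangentMapWithin (m := ∞) (by norm_cast) ho.uniqueMDiffOn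
  have h3 : ContMDiffOn 𝓘(ℝ, Fin n → ℂ) (𝓘(ℝ, Fin n → ℂ).prod 𝓘(ℝ, Fin n → ℂ)) ∞
      (fun z => TotalSpace.mk' (Fin n → ℂ)
        (E := fun x : Fin n → ℂ => TangentSpace 𝓘(ℝ, Fin n → ℂ) x) z u)
      (chartAt (Fin n → ℂ) c).target :=
    contMDiffOn_vectorSpace_iff_contDiffOn.2 contDiffOn_const
  refine (h2.comp h3 fun z hz => hz).congr fun z hz => ?_
  simp only [Function.comp_apply, tangentMapWithin]
  rw [mfderivWithin_of_isOpen ho hz]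

theorem HermitianMetric.contDiffOn_inner (g : HermitianMetric n X) (c : X) (u w : Fin n → ℂ) :
    ContDiffOn ℝ ∞ (fun z => g.inner ((chartAt (Fin n → ℂ) c).symm z)
      (mfderiv 𝓘(ℝ, Fin n → ℂ) 𝓘(ℝ, Fin n → ℂ) (chartAt (Fin n → ℂ) c).symm z u)
      (mfderiv 𝓘(ℝ, Fin n → ℂ) 𝓘(ℝ, Fin n → ℂ) (chartAt (Fin n → ℂ) c).symm z w))
      (chartAt (Fin n → ℂ) c).target := by
  have h1 : ContMDiffOn 𝓘(ℝ, Fin n → ℂ) 𝓘(ℝ, Fin n → ℂ) ∞ (chartAt (Fin n → ℂ) c).symm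
      (chartAt (Fin n → ℂ) c).target := contMDiffOn_chart_symm
  have hg := g.contMDiff.comp_contMDiffOn h1
  rw [← contMDiffOn_iff_contDiffOn]
  intro z hz
  have : ContMDiffWithinAt 𝓘(ℝ, Fin n → ℂ) (𝓘(ℝ, Fin n → ℂ).prod 𝓘(ℝ)) ∞
      (fun z ↦ TotalSpace.mk' ℝ (E := Bundle.Trivial X ℝ) ((chartAt (Fin n → ℂ) c).symm z)
        (g.inner ((chartAt (Fin n → ℂ) c).symm z)
      (mfderiv 𝓘(ℝ, Fin n → ℂ) 𝓘(ℝ, Fin n → ℂ) (chartAt (Fin n → ℂ) c).symm z u)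
      (mfderiv 𝓘(ℝ, Fin n → ℂ) 𝓘(ℝ, Fin n → ℂ) (chartAt (Fin n → ℂ) c).symm z w)))
      (chartAt (Fin n → ℂ) c).target z := by
    apply ContMDiffWithinAt.clm_bundle_apply₂ (F₁ := Fin n → ℂ) (F₂ := Fin n → ℂ)
    · exact hg z hz
    · exact contMDiffOn_mfderiv_chartAt_symm c u z hz
    · exact contMDiffOn_mfderiv_chartAt_symm c w z hz
  simp only [contMDiffWithinAt_totalSpace] at this
  exact this.2

theorem HermitianMetric.isSmooth_fundamentalForm (g : HermitianMetric n X) :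
    g.fundamentalForm.IsSmooth := by
  intro c
  refine contDiffOn_altForm fun v => ?_
  refine (Complex.ofRealCLM.contDiff.comp_contDiffOn
    (g.contDiffOn_inner c (mulI n (v 0)) (v 1))).congr fun z hz => ?_
  -- Since the chart is holomorphic, J passes inside the derivative, and the coefficient becomes a
  -- metric pairing of two coordinate fields.
  have hJ : mfderiv 𝓘(ℝ, Fin n → ℂ) 𝓘(ℝ, Fin n → ℂ) (chartAt (Fin n → ℂ) c).symm z
      (mulI n (v 0)) = complexStructure _
      (mfderiv 𝓘(ℝ, Fin n → ℂ) 𝓘(ℝ, Fin n → ℂ) (chartAt (Fin n → ℂ) c).symm z (v 0)) := by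
    rw [mfderiv_chartAt_symm hz]
    exact fderiv_transition_mulI (mem_transition_self_source hz) (v 0)
  simp only [Function.comp_apply]
  rw [hJ]
  rfl

omit [IsManifold 𝓘(ℂ, Fin n → ℂ) ω X] in
theorem Form.isSmooth_one : Form.IsSmooth (n := n) (X := X) (m := 0)
    (fun _ => ContinuousAlternatingMap.constOfIsEmpty ℝ _ (Fin 0) 1) := fun c => by
  refine contDiffOn_altForm fun v => ?_
  exact contDiffOn_const (c := (1 : ℂ))

omit [IsManifold 𝓘(ℂ, Fin n → ℂ) ω X] in
theorem Form.IsSmooth.pow {α : Form n X 2} (hα : α.IsSmooth) (k : ℕ) : (α.pow k).IsSmooth := by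
  induction k with
  | zero => exact Form.isSmooth_one
  | succ k ih => exact ih.wedge hα

end FundamentalForm

/-! ### Integration of forms and Stokes' theorem -/

section TopDegree

variable {V : Type*} [NormedAddCommGroup V] [NormedSpace ℝ V] [FiniteDimensional ℝ V] {m : ℕ}

/-- Every top-degree form is a multiple of the determinant in a basis. -/
theorem altForm_apply_comp_top (hm : Module.finrank ℝ V = m) (a : AltForm V m) (L : V →L[ℝ] V)
    (v : Fin m → V) : a (L ∘ v) = L.det • a v := by
  let e := Module.finBasisOfFinrankEq ℝ V hm
  have h : a.toAlternatingMap =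
      ((LinearMap.toSpanSingleton ℝ ℂ (a e)).compAlternatingMap e.det) := by
    refine Module.Basis.ext_alternating e fun w hw => ?_
    obtain ⟨σ, rfl⟩ : ∃ σ : Equiv.Perm (Fin m), w = σ :=
      ⟨Equiv.ofBijective w (Finite.injective_iff_bijective.1 hw), rfl⟩
    have h1 := a.toAlternatingMap.map_perm e σ
    have h2 := e.det.map_perm e σ
    simp only [Function.comp_def] at h1 h2
    rw [h1]
    simp only [LinearMap.compAlternatingMap_apply]
    rw [h2, Module.Basis.det_self]
    rcases Int.units_eq_one_or (Equiv.Perm.sign σ) with h | h <;> simp [h]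
  have h' (w : Fin m → V) : a w = e.det w • a e := congrArg (fun f => f w) h
  rw [h' (L ∘ v), h' v, smul_smul]
  congr 1
  exact e.det_comp (L : V →ₗ[ℝ] V) v

end TopDegree

namespace Form

open MeasureTheory

variable {n m : ℕ} {X : Type*} [TopologicalSpace X] [ChartedSpace (Fin n → ℂ) X]

/-- The product of a form with a real function. -/
def mulFun (f : X → ℝ) (α : Form n X m) : Form n X m := fun x => f x • α x

theorem inChart_mulFun (f : X → ℝ) (α : Form n X m) (c : X) (z : Fin n → ℂ) :
    (mulFun f α).inChart c z = f ((chartAt (Fin n → ℂ) c).symm z) • α.inChart c z := rfl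

theorem inChart_eq_zero {α : Form n X m} {c : X} {z : Fin n → ℂ}
    (h : α ((chartAt (Fin n → ℂ) c).symm z) = 0) : α.inChart c z = 0 := by
  rw [inChart, h]
  rfl

theorem density_mulFun (hm : m = 2 * n) (f : X → ℝ) (α : Form n X m) (c : X) (z : Fin n → ℂ) :
    (mulFun f α).density hm c z =
      (f ((chartAt (Fin n → ℂ) c).symm z) : ℂ) * α.density hm c z := by
  simp [density, inChart_mulFun]

theorem density_eq_zero (hm : m = 2 * n) {α : Form n X m} {c : X} {z : Fin n → ℂ}
    (h : α ((chartAt (Fin n → ℂ) c).symm z) = 0) : α.density hm c z = 0 := by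
  rw [density, inChart_eq_zero h]
  rfl

theorem IsSmooth.continuousOn_density (hm : m = 2 * n) {α : Form n X m} (hα : α.IsSmooth) (c : X) :
    ContinuousOn (α.density hm c) (chartAt (Fin n → ℂ) c).target :=
  ((ContinuousAlternatingMap.apply ℝ (Fin n → ℂ) ℂ fun j =>
    realFrame n (Fin.cast hm j)).continuous.comp_continuousOn (hα c).continuousOn)

theorem IsSmooth.integrableOn_density [T2Space X] (hm : m = 2 * n) {α : Form n X m}
    (hα : α.IsSmooth) {c : X} {K : Set X} (hK : IsCompact K) (hKc : K ⊆ (chartAt (Fin n → ℂ) c).source)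
    (h0 : ∀ x ∉ K, α x = 0) :
    IntegrableOn (α.density hm c) (chartAt (Fin n → ℂ) c).target := by
  have hK' : IsCompact (chartAt (Fin n → ℂ) c '' K) :=
    hK.image_of_continuousOn ((chartAt (Fin n → ℂ) c).continuousOn.mono hKc)
  have hsub : chartAt (Fin n → ℂ) c '' K ⊆ (chartAt (Fin n → ℂ) c).target := by
    rintro _ ⟨x, hx, rfl⟩
    exact (chartAt (Fin n → ℂ) c).map_source (hKc hx)
  refine (((hα.continuousOn_density hm c).mono hsub).integrableOn_compact hK').of_forall_sdiff_eq_zero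
    (chartAt (Fin n → ℂ) c).open_target.measurableSet fun z hz => ?_
  refine density_eq_zero hm (h0 _ fun hzK => hz.2 ⟨_, hzK, ?_⟩)
  exact (chartAt (Fin n → ℂ) c).right_inv hz.1

section Smooth

variable [IsManifold 𝓘(ℂ, Fin n → ℂ) ω X]

theorem IsSmooth.mulFun {f : X → ℝ} (hf : ContMDiff 𝓘(ℝ, Fin n → ℂ) 𝓘(ℝ) ∞ f) {α : Form n X m}
    (hα : α.IsSmooth) : (mulFun f α).IsSmooth := fun c => by
  have h1 : ContMDiffOn 𝓘(ℝ, Fin n → ℂ) 𝓘(ℝ, Fin n → ℂ) ∞ (chartAt (Fin n → ℂ) c).symm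
      (chartAt (Fin n → ℂ) c).target := contMDiffOn_chart_symm
  exact ((contMDiffOn_iff_contDiffOn.1 (hf.comp_contMDiffOn h1))).smul (hα c)

/-- The integral of a top-degree form over a chart does not depend on the chart. -/
theorem setIntegral_density_eq (hm : m = 2 * n) {α : Form n X m} {c y : X}
    (hc : ∀ x ∉ (chartAt (Fin n → ℂ) c).source, α x = 0)
    (hy : ∀ x ∉ (chartAt (Fin n → ℂ) y).source, α x = 0) :
    ∫ z in (chartAt (Fin n → ℂ) c).target, α.density hm c z =
      ∫ z in (chartAt (Fin n → ℂ) y).target, α.density hm y z := by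
  set T := transition n c y
  have hTs : T.source ⊆ (chartAt (Fin n → ℂ) c).target := fun z hz =>
    (mem_transition_source.1 hz).1
  have himg : T '' T.source = T.target := T.image_source_eq_target
  have hTt : T.target ⊆ (chartAt (Fin n → ℂ) y).target := by
    rw [← himg]
    rintro _ ⟨z, hz, rfl⟩
    exact transition_mem_target hz
  -- As α vanishes off both chart domains, both integrals live on the overlap.
  have e1 : ∫ z in (chartAt (Fin n → ℂ) c).target, α.density hm c z =
      ∫ z in T.source, α.density hm c z := by
    refine (setIntegral_eq_of_subset_of_forall_sdiff_eq_zero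
      (chartAt (Fin n → ℂ) c).open_target.measurableSet hTs fun z hz => ?_)
    exact density_eq_zero hm (hy _ fun h => hz.2 (mem_transition_source.2 ⟨hz.1, h⟩))
  have e2 : ∫ z in (chartAt (Fin n → ℂ) y).target, α.density hm y z =
      ∫ z in T.target, α.density hm y z := by
    refine (setIntegral_eq_of_subset_of_forall_sdiff_eq_zero
      (chartAt (Fin n → ℂ) y).open_target.measurableSet hTt fun z hz => ?_)
    refine density_eq_zero hm (hc _ fun h => hz.2 ?_)
    rw [← himg]
    refine ⟨chartAt (Fin n → ℂ) c ((chartAt (Fin n → ℂ) y).symm z), ?_, ?_⟩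
    · refine mem_transition_source.2 ⟨(chartAt (Fin n → ℂ) c).map_source h, ?_⟩
      rw [(chartAt (Fin n → ℂ) c).left_inv h]
      exact (chartAt (Fin n → ℂ) y).map_target hz.1
    · rw [transition_apply, (chartAt (Fin n → ℂ) c).left_inv h,
        (chartAt (Fin n → ℂ) y).right_inv hz.1]
  rw [e1, e2, ← himg, integral_image_eq_integral_abs_det_fderiv_smul volume
    T.open_source.measurableSet
    (fun z hz => (differentiableAt_transition hz).hasFDerivAt.hasFDerivWithinAt) T.injOn]
  refine setIntegral_congr_fun T.open_source.measurableSet fun z hz => ?_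
  -- The Jacobian is nonnegative, so its absolute value is the factor by which a top-degree form
  -- transforms.
  rw [abs_of_nonneg (det_fderiv_transition_nonneg hz), density, inChart_eq_pullback α hz, density]
  refine altForm_apply_comp_top ?_ (α.inChart y (T z)) (fderiv ℝ T z) _
  rw [hm, Module.finrank_pi_fintype]
  simp [Complex.finrank_real_complex, mul_comm]

theorem diff_eq_zero (κ : ℂ) {α : Form n X m} {x : X} (h : ∀ᶠ y in nhds x, α y = 0) :
    α.diff κ x = 0 := by
  have h2 : α.inChart x =ᶠ[nhds (chartAt (Fin n → ℂ) x x)] fun _ => 0 := by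
    have hcont : Filter.Tendsto (chartAt (Fin n → ℂ) x).symm (nhds (chartAt (Fin n → ℂ) x x))
        (nhds x) := by
      have := (chartAt (Fin n → ℂ) x).continuousAt_symm (mem_chart_target (Fin n → ℂ) x)
      rwa [ContinuousAt, (chartAt (Fin n → ℂ) x).left_inv (mem_chart_source _ x)] at this
    filter_upwards [hcont.eventually h] with z hz
    exact inChart_eq_zero hz
  change (α.diff κ).value x = 0
  rw [value_diff, dLocal_congr h2, dLocal]
  ext v
  simp [ContinuousAlternatingMap.alternatizeUncurryFin_apply, linearPart_apply]

/-- The integral of `∂α` or `∂̄α` over a chart vanishes if the support of `α` is a compact subset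
of the domain of the chart. -/
theorem setIntegral_density_diff_eq_zero [T2Space X] (κ : ℂ) (hm : m + 1 = 2 * n) {α : Form n X m}
    (hα : α.IsSmooth) {c : X} {K : Set X} (hK : IsCompact K)
    (hKc : K ⊆ (chartAt (Fin n → ℂ) c).source) (h0 : ∀ x ∉ K, α x = 0) :
    ∫ z in (chartAt (Fin n → ℂ) c).target, (α.diff κ).density hm c z = 0 := by
  set U := (chartAt (Fin n → ℂ) c).target with hU
  have hUo : IsOpen U := (chartAt (Fin n → ℂ) c).open_target
  set K' := chartAt (Fin n → ℂ) c '' K with hK'def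
  have hK' : IsCompact K' :=
    hK.image_of_continuousOn ((chartAt (Fin n → ℂ) c).continuousOn.mono hKc)
  have hsub : K' ⊆ U := by
    rintro _ ⟨x, hx, rfl⟩
    exact (chartAt (Fin n → ℂ) c).map_source (hKc hx)
  -- Extension by zero from the chart. It is smooth because U and the complement of the compact set
  -- K' form an open cover of ℂⁿ.
  let η : (Fin n → ℂ) → AltForm (Fin n → ℂ) m := U.indicator (α.inChart c)
  have hη0 : ∀ z ∉ K', η z = 0 := by
    intro z hz
    by_cases hzU : z ∈ U
    · rw [show η z = α.inChart c z from Set.indicator_of_mem hzU _]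
      exact inChart_eq_zero (h0 _ fun h => hz ⟨_, h, (chartAt (Fin n → ℂ) c).right_inv hzU⟩)
    · exact Set.indicator_of_notMem hzU _
  have hηe : ∀ z ∈ U, η =ᶠ[nhds z] α.inChart c := fun z hz => by
    filter_upwards [hUo.mem_nhds hz] with w hw
    exact Set.indicator_of_mem hw _
  have hηz : ∀ z ∉ K', η =ᶠ[nhds z] fun _ => 0 := fun z hz => by
    filter_upwards [hK'.isClosed.isOpen_compl.mem_nhds hz] with w hw
    exact hη0 w hw
  have hηs : ContDiff ℝ 1 η := by
    rw [contDiff_iff_contDiffAt]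
    intro z
    by_cases hz : z ∈ K'
    · exact (((hα c).contDiffAt (hUo.mem_nhds (hsub hz))).of_le (by norm_cast)).congr_of_eventuallyEq
        (hηe z (hsub hz))
    · exact (contDiffAt_const (c := (0 : AltForm (Fin n → ℂ) m))).congr_of_eventuallyEq (hηz z hz)
  have hηc : HasCompactSupport η := HasCompactSupport.intro hK' hη0
  set w := fun j => realFrame n (Fin.cast hm j)
  calc ∫ z in U, (α.diff κ).density hm c z = ∫ z in U, dLocal κ η z w := by
        refine setIntegral_congr_fun hUo.measurableSet fun z hz => ?_
        change (α.diff κ).inChart c z w = _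
        rw [inChart_diff κ hα hz, dLocal_congr (hηe z hz)]
    _ = ∫ z, dLocal κ η z w := by
        refine setIntegral_eq_integral_of_forall_compl_eq_zero fun z hz => ?_
        rw [dLocal_congr (hηz z fun h => hz (hsub h)), dLocal]
        simp [ContinuousAlternatingMap.alternatizeUncurryFin_apply, linearPart_apply]
    _ = 0 := integral_dLocal_eq_zero κ hηs hηc w

/-! ### Integration over the manifold -/

section Global

variable [T2Space X] [CompactSpace X]

theorem tsupport_chartPartition_subset (c : X) :
    tsupport (chartPartition n X c) ⊆ (chartAt (Fin n → ℂ) c).source :=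
  (SmoothPartitionOfUnity.exists_isSubordinate_chartAt_source 𝓘(ℝ, Fin n → ℂ) X).choose_spec c

variable (n X) in
theorem exists_finset_chartPartition :
    ∃ S : Finset X, (∀ c ∉ S, ∀ x, chartPartition n X c x = 0) ∧
      ∀ x, ∑ c ∈ S, chartPartition n X c x = 1 := by
  have hfin := (chartPartition n X).locallyFinite.finite_nonempty_of_compact
  have h0 : ∀ c ∉ hfin.toFinset, ∀ x, chartPartition n X c x = 0 := by
    intro c hc x
    by_contra h
    exact hc (hfin.mem_toFinset.2 ⟨x, h⟩)
  refine ⟨hfin.toFinset, h0, fun x => ?_⟩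
  rw [← (chartPartition n X).sum_eq_one (Set.mem_univ x)]
  refine (finsum_eq_sum_of_support_subset _ fun c hc => ?_).symm
  by_contra h
  exact hc (h0 c h x)

theorem chartPartition_mulFun_eq_zero (α : Form n X m) (c : X) {x : X}
    (hx : x ∉ tsupport (chartPartition n X c)) : mulFun (chartPartition n X c) α x = 0 := by
  rw [mulFun, image_eq_zero_of_notMem_tsupport hx]
  exact zero_smul ℝ (α.value x)

theorem IsSmooth.mulFun_chartPartition {α : Form n X m} (hα : α.IsSmooth) (c : X) :
    (Form.mulFun (chartPartition n X c) α).IsSmooth :=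
  hα.mulFun (chartPartition n X c).contMDiff

theorem integral_eq_sum (hm : m = 2 * n) (α : Form n X m) {S : Finset X}
    (hS : ∀ c ∉ S, ∀ x, chartPartition n X c x = 0) :
    integral hm α = ∑ c ∈ S, ∫ z in (chartAt (Fin n → ℂ) c).target,
      (Form.mulFun (chartPartition n X c) α).density hm c z := by
  simp only [density_mulFun]
  refine finsum_eq_sum_of_support_subset _ fun c hc => ?_
  by_contra h
  refine hc ?_
  simp [hS c h]

theorem IsSmooth.integrableOn_chartPartition (hm : m = 2 * n) {α : Form n X m} (hα : α.IsSmooth)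
    (c : X) : IntegrableOn ((Form.mulFun (chartPartition n X c) α).density hm c)
      (chartAt (Fin n → ℂ) c).target :=
  (hα.mulFun_chartPartition c).integrableOn_density hm (isClosed_tsupport _).isCompact
    (tsupport_chartPartition_subset c) fun _ hx => chartPartition_mulFun_eq_zero α c hx

theorem integral_add (hm : m = 2 * n) {α β : Form n X m} (hα : α.IsSmooth) (hβ : β.IsSmooth) :
    integral hm (fun x => α x + β x) = integral hm α + integral hm β := by
  obtain ⟨S, hS, -⟩ := exists_finset_chartPartition n X
  simp only [integral_eq_sum hm _ hS, ← Finset.sum_add_distrib]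
  refine Finset.sum_congr rfl fun c _ => ?_
  rw [← MeasureTheory.integral_add (hα.integrableOn_chartPartition hm c)
    (hβ.integrableOn_chartPartition hm c)]
  refine integral_congr_ae (Filter.Eventually.of_forall fun z => ?_)
  simp only [density_mulFun, ← mul_add]
  rfl

theorem integral_nsmul (hm : m = 2 * n) (k : ℕ) (α : Form n X m) :
    integral hm (fun x => k • α x) = k * integral hm α := by
  obtain ⟨S, hS, -⟩ := exists_finset_chartPartition n X
  simp only [integral_eq_sum hm _ hS, Finset.mul_sum]
  refine Finset.sum_congr rfl fun c _ => ?_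
  rw [← MeasureTheory.integral_const_mul]
  refine integral_congr_ae (Filter.Eventually.of_forall fun z => ?_)
  have : density hm (fun x => k • α x) c z = k * density hm α c z := by
    rw [← nsmul_eq_mul]
    rfl
  simp only [density_mulFun, this]
  ring

/-- Stokes' theorem for `∂` and `∂̄` on a compact complex manifold. -/
theorem integral_diff_eq_zero (κ : ℂ) (hm : m + 1 = 2 * n) {β : Form n X m} (hβ : β.IsSmooth) :
    integral hm (β.diff κ) = 0 := by
  obtain ⟨S, hS, hS1⟩ := exists_finset_chartPartition n X
  set ρ := chartPartition n X
  -- A second use of the partition of unity: β = Σ ρ_y β is split before differentiating,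
  -- independently of the ρ_c in the definition of the integral.
  let γ (y : X) : Form n X (m + 1) := (Form.mulFun (ρ y) β).diff κ
  have hγ (y : X) : (γ y).IsSmooth := (hβ.mulFun_chartPartition y).diff κ
  have hγ0 (y : X) : ∀ x ∉ tsupport (ρ y), γ y x = 0 := fun x hx => by
    refine diff_eq_zero κ ?_
    filter_upwards [(isClosed_tsupport _).isOpen_compl.mem_nhds hx] with w hw
    exact chartPartition_mulFun_eq_zero β y hw
  have hsum (c : X) (z : Fin n → ℂ) (hz : z ∈ (chartAt (Fin n → ℂ) c).target) :
      (β.diff κ).density hm c z = ∑ y ∈ S, (γ y).density hm c z := by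
    have h1 : β.inChart c = fun z => ∑ y ∈ S, (Form.mulFun (ρ y) β).inChart c z := by
      ext1 z
      simp only [inChart_mulFun, ← Finset.sum_smul]
      rw [hS1, one_smul]
    have h2 : (β.diff κ).inChart c z = ∑ y ∈ S, (γ y).inChart c z := by
      rw [inChart_diff κ hβ hz, h1, dLocal_sum]
      · exact Finset.sum_congr rfl fun y _ =>
          (inChart_diff κ (hβ.mulFun_chartPartition y) hz).symm
      · exact fun y _ => (hβ.mulFun_chartPartition y).differentiableAt hz
    simp only [density]
    rw [h2, ContinuousAlternatingMap.sum_apply]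
  have hmulc (c y : X) : ∀ x ∉ tsupport (ρ c), Form.mulFun (ρ c) (γ y) x = 0 := fun x hx =>
    chartPartition_mulFun_eq_zero (γ y) c hx
  have hmuly (c y : X) : ∀ x ∉ tsupport (ρ y), Form.mulFun (ρ c) (γ y) x = 0 := fun x hx => by
    rw [Form.mulFun, hγ0 y x hx]
    exact smul_zero (A := AltForm (Fin n → ℂ) (m + 1)) (ρ c x)
  calc integral hm (β.diff κ)
      = ∑ c ∈ S, ∑ y ∈ S, ∫ z in (chartAt (Fin n → ℂ) c).target,
          (Form.mulFun (ρ c) (γ y)).density hm c z := by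
        rw [integral_eq_sum hm _ hS]
        refine Finset.sum_congr rfl fun c _ => ?_
        rw [← integral_finsetSum _ fun y _ => (hγ y).integrableOn_chartPartition hm c]
        refine setIntegral_congr_fun (chartAt (Fin n → ℂ) c).open_target.measurableSet
          fun z hz => ?_
        simp only [density_mulFun, hsum c z hz, Finset.mul_sum]
    -- The form ρ_c γ_y is supported in both chart domains, so its integral can be moved from the
    -- chart at c to the chart at y.
    _ = ∑ c ∈ S, ∑ y ∈ S, ∫ z in (chartAt (Fin n → ℂ) y).target,
          (Form.mulFun (ρ c) (γ y)).density hm y z := by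
        refine Finset.sum_congr rfl fun c _ => Finset.sum_congr rfl fun y _ => ?_
        exact setIntegral_density_eq hm
          (fun x hx => hmulc c y x fun h => hx (tsupport_chartPartition_subset c h))
          (fun x hx => hmuly c y x fun h => hx (tsupport_chartPartition_subset y h))
    _ = ∑ y ∈ S, ∑ c ∈ S, ∫ z in (chartAt (Fin n → ℂ) y).target,
          (Form.mulFun (ρ c) (γ y)).density hm y z := Finset.sum_comm
    -- With the chart fixed, summing over c removes ρ_c and leaves the derivative of a form
    -- supported in one chart.
    _ = ∑ y ∈ S, ∫ z in (chartAt (Fin n → ℂ) y).target, (γ y).density hm y z := by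
        refine Finset.sum_congr rfl fun y _ => ?_
        rw [← integral_finsetSum _ fun c _ =>
          ((hγ y).mulFun_chartPartition c).integrableOn_density hm (isClosed_tsupport _).isCompact
            (tsupport_chartPartition_subset y) (hmuly c y)]
        refine integral_congr_ae (Filter.Eventually.of_forall fun z => ?_)
        simp only [density_mulFun, ← Finset.sum_mul]
        have := hS1 ((chartAt (Fin n → ℂ) y).symm z)
        rw [← Complex.ofReal_sum, this]
        simp
    _ = 0 := Finset.sum_eq_zero fun y _ =>
        setIntegral_density_diff_eq_zero κ hm (hβ.mulFun_chartPartition y)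
          (isClosed_tsupport _).isCompact (tsupport_chartPartition_subset y)
          fun x hx => chartPartition_mulFun_eq_zero β y hx

end Global

end Smooth

end Form

/-! ### `∂` and `∂̄` of the powers of a 2-form -/

theorem toRing_injective {V : Type*} [NormedAddCommGroup V] [NormedSpace ℝ V] {m : ℕ} :
    Function.Injective (toRing : AltForm V m → FormRing V) := fun a b h => by
  rw [← component_toRing a, h, component_toRing]

namespace Form

variable {n m p q r : ℕ} {X : Type*} [TopologicalSpace X] [ChartedSpace (Fin n → ℂ) X]

theorem IsSmooth.nsmul {α : Form n X m} (hα : α.IsSmooth) (k : ℕ) :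
    IsSmooth (fun x => k • α x) := fun c => by
  have h : ContDiffOn ℝ ∞ (fun z => (k : ℝ) • α.inChart c z) (chartAt (Fin n → ℂ) c).target :=
    ContDiffOn.const_smul (k : ℝ) (hα c)
  exact h.congr fun z _ =>
    (Nat.cast_smul_eq_nsmul ℝ k (show AltForm (Fin n → ℂ) m from α.inChart c z)).symm

theorem toRing_value_pow (α : Form n X 2) (k : ℕ) (x : X) :
    toRing ((α.pow k).value x) = toRing (α.value x) ^ k := by
  induction k with
  | zero =>
    rw [pow_zero]
    exact toRing_one
  | succ k ih =>
    rw [pow_succ, ← ih, ← toRing_wedge]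
    rfl

variable [IsManifold 𝓘(ℂ, Fin n → ℂ) ω X]

theorem value_diff_nsmul (κ : ℂ) {α : Form n X m} (hα : α.IsSmooth) (k : ℕ) (x : X) :
    (diff κ (fun x => k • α x)).value x = k • (α.diff κ).value x := by
  rw [value_diff, value_diff]
  have h1 : inChart (fun x => k • α x) x = fun z => ∑ _i ∈ Finset.range k, α.inChart x z := by
    ext1 z
    rw [Finset.sum_const, Finset.card_range]
    rfl
  rw [h1, dLocal_sum _ _ _ _ fun _ _ => hα.differentiableAt (mem_chart_target _ x)]
  simp

/-- Lets an identity in the ring, valid at every point, be differentiated even when the two degrees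
are not equal by definition. -/
theorem toRing_diff_of_eq_nsmul (κ : ℂ) (h : p = q) {α : Form n X p} {β : Form n X q}
    (hβ : β.IsSmooth) (k : ℕ) (hαβ : ∀ x, toRing (α.value x) = k • toRing (β.value x)) (x : X) :
    toRing ((α.diff κ).value x) = k • toRing ((β.diff κ).value x) := by
  subst h
  have : α = fun x => k • β x := by
    ext1 x
    refine toRing_injective (V := Fin n → ℂ) ?_
    refine (hαβ x).trans ?_
    rw [← map_nsmul]
    rfl
  rw [this, value_diff_nsmul κ hβ, map_nsmul]

theorem value_diff_pow_zero (κ : ℂ) (α : Form n X 2) (x : X) :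
    ((α.pow 0).diff κ).value x = 0 := by
  rw [value_diff]
  have h1 : (α.pow 0).inChart x = fun _ =>
      ContinuousAlternatingMap.constOfIsEmpty ℝ (Fin n → ℂ) (Fin 0) (1 : ℂ) := rfl
  rw [h1, dLocal]
  ext v
  simp [ContinuousAlternatingMap.alternatizeUncurryFin_apply, linearPart_apply]

/-- Induction by the Leibniz rule; α has even degree and is central, so there are no signs and the
powers collect on the right. -/
theorem toRing_diff_pow (κ : ℂ) {α : Form n X 2} (hα : α.IsSmooth) (k : ℕ) (x : X) :
    toRing (((α.pow (k + 1)).diff κ).value x) =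
      (k + 1) • (toRing ((α.diff κ).value x) * toRing (α.value x) ^ k) := by
  have step (k : ℕ) : toRing (((α.pow (k + 1)).diff κ).value x) =
      toRing (((α.pow k).diff κ).value x) * toRing (α.value x) +
        toRing ((α.diff κ).value x) * toRing (α.value x) ^ k := by
    have h := toRing_diff_wedge κ (hα.pow k) hα x
    have hc := (toRing_commute_of_two (α.value x) (toRing ((α.diff κ).value x))).pow_left k
    rw [toRing_value_pow, pow_mul, neg_one_sq, one_pow, one_mul, hc.eq] at h
    exact h
  induction k with
  | zero => rw [step, value_diff_pow_zero]; simp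
  | succ k ih => rw [step, ih, smul_mul_assoc, mul_assoc, ← pow_succ, ← succ_nsmul]

/-- For j > 0 both sides are j(j+l) dα ∧ α^(j+l-1), with d the operator for κ; for j = 0 both
vanish. Cross-multiplying avoids division and the exponent j - 1. -/
theorem nsmul_toRing_diff_pow_mul (κ : ℂ) {α : Form n X 2} (hα : α.IsSmooth) (j l : ℕ) (x : X) :
    (j + l) • (toRing (((α.pow j).diff κ).value x) * toRing (α.value x) ^ l) =
      j • toRing (((α.pow (j + l)).diff κ).value x) := by
  cases j with
  | zero => rw [value_diff_pow_zero]; simp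
  | succ i =>
    have hil : i + 1 + l = (i + l) + 1 := by omega
    rw [hil, toRing_diff_pow κ hα, toRing_diff_pow κ hα, smul_mul_assoc, mul_assoc, ← pow_add,
      smul_comm]

/-- `∂∂̄(αʲ⁺¹) ∧ αˡ` in terms of `∂∂̄α ∧ αʲ⁺ˡ` and the exact form `∂(∂̄α ∧ αʲ⁺ˡ)`. -/
theorem toRing_diff_diff_pow_wedge (κ κ' : ℂ) {α : Form n X 2} (hα : α.IsSmooth) (j l : ℕ)
    (x : X) :
    (j + l) • toRing (((((α.pow (j + 1)).diff κ').diff κ).wedge (α.pow l)).value x) +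
        ((j + 1) * j) • toRing ((((α.diff κ').diff κ).wedge (α.pow (j + l))).value x) =
      ((j + 1) * (j + l)) • toRing ((((α.diff κ').diff κ).wedge (α.pow (j + l))).value x) +
        ((j + 1) * j) • toRing ((((α.diff κ').wedge (α.pow (j + l))).diff κ).value x) := by
  -- The minus sign comes from the odd degree 2 + 1 of ∂̄α.
  have hS (i : ℕ) : toRing ((((α.diff κ').wedge (α.pow i)).diff κ).value x) =
      toRing (((α.diff κ').diff κ).value x) * toRing (α.value x) ^ i -
        toRing ((α.diff κ').value x) * toRing (((α.pow i).diff κ).value x) := by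
    rw [toRing_diff_wedge κ (hα.diff κ') (hα.pow i), toRing_value_pow]
    have : (-1 : FormRing (Fin n → ℂ)) ^ (2 + 1) = -1 := by norm_num
    rw [this, neg_one_mul, neg_mul, sub_eq_add_neg]
  have hA : toRing ((((α.pow (j + 1)).diff κ').diff κ).value x) =
      (j + 1) • toRing ((((α.diff κ').wedge (α.pow j)).diff κ).value x) := by
    refine toRing_diff_of_eq_nsmul κ (by ring) ((hα.diff κ').wedge (hα.pow j)) (j + 1)
      (fun y => ?_) x
    rw [toRing_diff_pow κ' hα, value_wedge, toRing_wedge, toRing_value_pow]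
  -- Turns (j+l) ∂αʲ ∧ αˡ into j ∂αʲ⁺ˡ, which `hS` relates to the exact form. Terms stand on the
  -- sides where all coefficients are natural numbers.
  have hD := nsmul_toRing_diff_pow_mul κ hα j l x
  rw [value_wedge, toRing_wedge, hA, hS, value_wedge, toRing_wedge, hS, toRing_value_pow,
    toRing_value_pow, smul_mul_assoc, sub_mul, mul_assoc, ← pow_add, mul_assoc, smul_comm (j + l),
    smul_sub (j + l), ← mul_smul_comm (j + l) (toRing ((α.diff κ').value x)), hD]
  simp only [mul_smul, smul_sub, mul_smul_comm]
  abel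

section Integral

variable [T2Space X] [CompactSpace X]

/-- Integrates a pointwise ring identity of the shape produced by `toRing_diff_diff_pow_wedge`,
whose three forms have different expressions for the degree 2n. -/
theorem integral_relation {α : Form n X p} {β : Form n X q} {γ : Form n X r} (hp : p = 2 * n)
    (hq : q = 2 * n) (hr : r = 2 * n) (hα : α.IsSmooth) (hβ : β.IsSmooth) (hγ : γ.IsSmooth)
    (a b c d : ℕ) (h : ∀ x, a • toRing (α.value x) + b • toRing (β.value x) =
      c • toRing (β.value x) + d • toRing (γ.value x)) :
    a * integral hp α + b * integral hq β = c * integral hq β + d * integral hr γ := by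
  subst hp hq hr
  simp only [← integral_nsmul]
  rw [← integral_add _ (hα.nsmul a) (hβ.nsmul b), ← integral_add _ (hβ.nsmul c) (hγ.nsmul d)]
  congr 1
  ext1 x
  refine toRing_injective (V := Fin n → ℂ) ?_
  have := h x
  simp only [← map_nsmul, ← map_add] at this
  exact this

end Integral

end Form

end ComplexManifold

end

/-! ### The integral identity -/

open ComplexManifold in
theorem proposition2p1 (n : ℕ) (hn : 3 ≤ n) (X : Type*) [TopologicalSpace X] [T2Space X]
    [CompactSpace X] [ChartedSpace (Fin n → ℂ) X] [IsManifold 𝓘(ℂ, Fin n → ℂ) ω X]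
    (g : HermitianMetric n X) (k : ℕ) (hk : 1 ≤ k) (hkn : k ≤ n - 1) :
    Form.integral (by omega)
        ((g.fundamentalForm.pow k).delbar.del.wedge (g.fundamentalForm.pow (n - k - 1))) =
      ((k : ℂ) * ((n : ℂ) - k - 1) / ((n : ℂ) - 2)) *
        Form.integral (by omega)
          (g.fundamentalForm.delbar.del.wedge (g.fundamentalForm.pow (n - 2))) := by
  obtain ⟨j, rfl⟩ : ∃ j, k = j + 1 := ⟨k - 1, by omega⟩
  -- Here l = n - k - 1 and j + l = n - 2, which removes truncated subtraction.
  obtain ⟨l, rfl⟩ : ∃ l, n = j + l + 2 := ⟨n - 2 - j, by omega⟩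
  have e1 : j + l + 2 - (j + 1) - 1 = l := by omega
  have e2 : j + l + 2 - 2 = j + l := by omega
  have hF := g.isSmooth_fundamentalForm
  -- The exponents occur in the degrees of the forms, so they are generalized to a and b before
  -- being replaced.
  suffices H : ∀ a b (_ : l = a) (_ : j + l = b)
      (h1 : 2 * (j + 1) + 1 + 1 + 2 * a = 2 * (j + l + 2))
      (h2 : 2 + 1 + 1 + 2 * b = 2 * (j + l + 2)),
      Form.integral h1
        ((g.fundamentalForm.pow (j + 1)).delbar.del.wedge (g.fundamentalForm.pow a)) =
      (((j + 1 : ℕ) : ℂ) * (((j + l + 2 : ℕ) : ℂ) - ((j + 1 : ℕ) : ℂ) - 1) /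
        (((j + l + 2 : ℕ) : ℂ) - 2)) *
        Form.integral h2
          (g.fundamentalForm.delbar.del.wedge (g.fundamentalForm.pow b)) from
    H _ _ e1.symm e2.symm _ _
  intro a b ha hb h1 h2
  subst ha hb
  simp only [Form.del_eq_diff, Form.delbar_eq_diff]
  have hS := Form.integral_diff_eq_zero (-Complex.I) (by omega)
    ((hF.diff Complex.I).wedge (hF.pow (j + l)))
  have h := Form.integral_relation (by omega) (by omega) (by omega)
    ((((hF.pow (j + 1)).diff Complex.I).diff (-Complex.I)).wedge (hF.pow l))
    (((hF.diff Complex.I).diff (-Complex.I)).wedge (hF.pow (j + l)))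
    (((hF.diff Complex.I).wedge (hF.pow (j + l))).diff (-Complex.I)) _ _ _ _
    (Form.toRing_diff_diff_pow_wedge (-Complex.I) Complex.I hF j l)
  rw [hS] at h
  -- j + l = n - 2 is nonzero because n ≥ 3.
  have hjl : ((j : ℂ) + l) ≠ 0 := by
    have : j + l ≠ 0 := by omega
    exact_mod_cast this
  push_cast at h ⊢
  have hd : ((j : ℂ) + l + 2 - 2) ≠ 0 := by simpa using hjl
  rw [div_mul_eq_mul_div, eq_div_iff hd]
  -- With I and I' the two integrals, `h` reads (j+l) I + (j+1)j I' = (j+1)(j+l) I', that is, (j+l)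
  -- I = (j+1)l I'.
  linear_combination h
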